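/- **Definitions.** A reflexive $3$-globular set $A$ consists of sets $A(0),\dots,A(3)$ with maps $s,t:A(k+1)\to A(k)$ and $i:A(k)\to A(k+1)$ satisfying $ss=st$, $ts=tt$, $si=ti=1$. A ($3$-dimensional) magma is such an $A$ together with composites $\beta\circ_k\alpha\in A(m)$ for all $k<m$ and all $\alpha,\beta\in A(m)$ with $t^{m-k}\alpha=s^{m-k}\beta$, with $s(\beta\circ_k\alpha)=s\alpha$ and $t(\beta\circ_k\alpha)=t\beta$ if $k=m-1$, and $s(\beta\circ_k\alpha)=s\beta\circ_k s\alpha$ and $t(\beta\circ_k\alpha)=t\beta\circ_k t\alpha$ if $k<m-1$; a strict $3$-category has an underlying magma. Two $k$-cells are parallel if $k=0$ or they have the same source and the same target. A contraction on a map $f:A\to B$ of reflexive $3$-globular sets gives, for all parallel $k$-cells $x,y$ of $A$ with $fx=fy$: if $k<3$, a $(k+1)$-cell $[x,y]:x\to y$ with $f[x,y]=i(fx)$ and $[x,x]=ix$; if $k=3$, the equality $x=y$. Let $\mathcal Q$ be the category whose objects are maps of magmas $f:M\to B$, with $B$ a strict $3$-category, equipped with a contraction on $f$, and whose morphisms are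 commuting squares of a map of magmas and a map of strict $3$-categories that preserve contraction cells. The functor $U$ from $\mathcal Q$ to reflexive $3$-globular sets, sending such an object to the underlying reflexive globular set of $M$, has a left adjoint $F$; let $P=UF$ be the induced monad, with unit $\eta$. Write $FA=(\varphi:PA\to T_RA)$. A Penon $3$-category is a $P$-algebra $\theta:PA\to A$. Composition in $A$ is defined by $y\circ_k x:=\theta(\eta y\circ_k\eta x)$. **Theorem.** Let $\theta:PA\to A$ be a Penon $3$-category such that $A$ has exactly one $0$-cell $*$ and exactly one $1$-cell. Then: 1. $T_RA$, with the map $\varphi\eta:A\to T_RA$, is the free strict $3$-category on the reflexive globular set $A$. 2. For all $\alpha,\beta\in A(2)$ one has $\varphi(\eta\alpha\circ_1\eta\beta)=\varphi(\eta\beta\circ_1\eta\alpha)$ in $T_RA$, so that there is a contraction cell $[\eta\alpha\circ_1\eta\beta,\ \eta\beta\circ_1\eta\alpha]$ in $PA$. 3. For every contraction $3$-cell $[x,y]$ of $PA$ one has $[x,y]\circ_2[y,x]=i(y)$. 4. There is a symmetric monoidal category (in particular, all axioms of a braided monoidal category hold, and $\gamma_{\beta,\alpha}\gamma_{\alpha,\beta}=1$)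 in which the objects are the elements of $A(2)$; the morphisms $\alpha\to\beta$ are the $3$-cells with source $\alpha$ and target $\beta$, with composition $\circ_2$ and identities $i(\alpha)$; the tensor product is $\alpha\otimes\beta=\alpha\circ_1\beta$ on objects and $f\otimes g=f\circ_1 g$ on morphisms; the unit object is $i(i(*))$; the associators $(\alpha\otimes\beta)\otimes\gamma\to\alpha\otimes(\beta\otimes\gamma)$ and the unitors $i(i(*))\otimes\alpha\to\alpha$, $\alpha\otimes i(i(*))\to\alpha$ are the images under $\theta$ of the contraction cells $[(\eta\alpha\circ_1\eta\beta)\circ_1\eta\gamma,\ \eta\alpha\circ_1(\eta\beta\circ_1\eta\gamma)]$, $[\eta i(i(*))\circ_1\eta\alpha,\ \eta\alpha]$ and $[\eta\alpha\circ_1\eta i(i(*)),\ \eta\alpha]$; and the braiding is $\gamma_{\alpha,\beta}=\theta[\eta\alpha\circ_1\eta\beta,\ \eta\beta\circ_1\eta\alpha]:\alpha\otimes\beta\to\beta\otimes\alpha$. -/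

import Mathlib

open CategoryTheory

universe u

namespace Penon

/-! ### Reflexive globular sets -/

/-- An `n`-dimensional reflexive globular set: sets `cell k` of `k`-cells for `k ≤ n` (there are no
cells of dimension `> n`), with sources, targets and putative identities. -/
structure RGSet (n : ℕ) where
  cell : ℕ → Type u
  isEmpty_cell : ∀ k, n < k → IsEmpty (cell k)
  s : ∀ {k : ℕ}, cell (k + 1) → cell k
  t : ∀ {k : ℕ}, cell (k + 1) → cell k
  i : ∀ {k : ℕ}, k < n → cell k → cell (k + 1)
  s_s : ∀ {k : ℕ} (x : cell (k + 2)), s (s x) = s (t x)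
  t_s : ∀ {k : ℕ} (x : cell (k + 2)), t (s x) = t (t x)
  s_i : ∀ {k : ℕ} (h : k < n) (x : cell k), s (i h x) = x
  t_i : ∀ {k : ℕ} (h : k < n) (x : cell k), t (i h x) = x

namespace RGSet

variable {n : ℕ} (A : RGSet.{u} n)

theorem dim_le {k : ℕ} (x : A.cell k) : k ≤ n :=
  not_lt.1 fun h => (A.isEmpty_cell k h).false x

/-- The iterated source `s^{m-k}`. -/
def sTo {k m : ℕ} (h : k ≤ m) : A.cell m → A.cell k :=
  Nat.leRec (motive := fun j _ => A.cell j → A.cell k) id (fun _ _ ih x => ih (A.s x)) h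

/-- The iterated target `t^{m-k}`. -/
def tTo {k m : ℕ} (h : k ≤ m) : A.cell m → A.cell k :=
  Nat.leRec (motive := fun j _ => A.cell j → A.cell k) id (fun _ _ ih x => ih (A.t x)) h

/-- The iterated putative identity `i^{m-k}`. -/
def iTo {k m : ℕ} (h : k ≤ m) (hm : m ≤ n) (x : A.cell k) : A.cell m :=
  Nat.leRec (motive := fun j _ => j ≤ n → A.cell j) (fun _ => x)
    (fun _ _ ih hj => A.i hj (ih (Nat.le_of_succ_le hj))) h hm

@[simp] theorem sTo_self {k : ℕ} (x : A.cell k) : A.sTo le_rfl x = x := by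
  simp [sTo]

@[simp] theorem tTo_self {k : ℕ} (x : A.cell k) : A.tTo le_rfl x = x := by
  simp [tTo]

@[simp] theorem iTo_self {k : ℕ} (hk : k ≤ n) (x : A.cell k) : A.iTo le_rfl hk x = x := by
  simp [iTo]

theorem sTo_succ {k m : ℕ} (h : k ≤ m) (h' : k ≤ m + 1) (x : A.cell (m + 1)) :
    A.sTo h' x = A.sTo h (A.s x) := by
  simp only [sTo]; rw [Nat.leRec_succ _ _ h]

theorem tTo_succ {k m : ℕ} (h : k ≤ m) (h' : k ≤ m + 1) (x : A.cell (m + 1)) :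
    A.tTo h' x = A.tTo h (A.t x) := by
  simp only [tTo]; rw [Nat.leRec_succ _ _ h]

theorem iTo_succ {k m : ℕ} (h : k ≤ m) (h' : k ≤ m + 1) (hm : m + 1 ≤ n) (x : A.cell k) :
    A.iTo h' hm x = A.i hm (A.iTo h (Nat.le_of_succ_le hm) x) := by
  simp only [iTo]; rw [Nat.leRec_succ _ _ h]

@[simp] theorem sTo_one {k : ℕ} (h : k ≤ k + 1) (x : A.cell (k + 1)) : A.sTo h x = A.s x := by
  rw [A.sTo_succ le_rfl, sTo_self]

@[simp] theorem tTo_one {k : ℕ} (h : k ≤ k + 1) (x : A.cell (k + 1)) : A.tTo h x = A.t x := by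
  rw [A.tTo_succ le_rfl, tTo_self]

theorem sTo_t {k m : ℕ} (h : k < m) (x : A.cell (m + 1)) :
    A.sTo h.le (A.t x) = A.sTo h.le (A.s x) := by
  obtain ⟨m, rfl⟩ : ∃ j, m = j + 1 := ⟨m - 1, by omega⟩
  have hk : k ≤ m := by omega
  rw [A.sTo_succ hk, A.sTo_succ hk, A.s_s]

theorem tTo_s {k m : ℕ} (h : k < m) (x : A.cell (m + 1)) :
    A.tTo h.le (A.s x) = A.tTo h.le (A.t x) := by
  obtain ⟨m, rfl⟩ : ∃ j, m = j + 1 := ⟨m - 1, by omega⟩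
  have hk : k ≤ m := by omega
  rw [A.tTo_succ hk, A.tTo_succ hk, A.t_s]

theorem sTo_sTo {j k m : ℕ} (h : j ≤ k) (h' : k ≤ m) (x : A.cell m) :
    A.sTo h (A.sTo h' x) = A.sTo (h.trans h') x := by
  induction m, h' using Nat.le_induction with
  | base => simp
  | succ m hm ih => rw [A.sTo_succ hm, ih, A.sTo_succ (h.trans hm)]

theorem tTo_tTo {j k m : ℕ} (h : j ≤ k) (h' : k ≤ m) (x : A.cell m) :
    A.tTo h (A.tTo h' x) = A.tTo (h.trans h') x := by
  induction m, h' using Nat.le_induction with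
  | base => simp
  | succ m hm ih => rw [A.tTo_succ hm, ih, A.tTo_succ (h.trans hm)]

theorem sTo_tTo {j k m : ℕ} (h : j < k) (h' : k ≤ m) (x : A.cell m) :
    A.sTo h.le (A.tTo h' x) = A.sTo (h.le.trans h') x := by
  induction m, h' using Nat.le_induction with
  | base => simp
  | succ m hm ih =>
    rw [A.tTo_succ hm, ih, A.sTo_succ (h.le.trans hm), A.sTo_t (h.trans_le hm)]

theorem tTo_sTo {j k m : ℕ} (h : j < k) (h' : k ≤ m) (x : A.cell m) :
    A.tTo h.le (A.sTo h' x) = A.tTo (h.le.trans h') x := by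
  induction m, h' using Nat.le_induction with
  | base => simp
  | succ m hm ih =>
    rw [A.sTo_succ hm, ih, A.tTo_succ (h.le.trans hm), A.tTo_s (h.trans_le hm)]

theorem sTo_iTo {k m : ℕ} (h : k ≤ m) (hm : m ≤ n) (x : A.cell k) :
    A.sTo h (A.iTo h hm x) = x := by
  induction m, h using Nat.le_induction with
  | base => simp
  | succ m h ih => rw [A.sTo_succ h, A.iTo_succ h, A.s_i, ih]

theorem tTo_iTo {k m : ℕ} (h : k ≤ m) (hm : m ≤ n) (x : A.cell k) :
    A.tTo h (A.iTo h hm x) = x := by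
  induction m, h using Nat.le_induction with
  | base => simp
  | succ m h ih => rw [A.tTo_succ h, A.iTo_succ h, A.t_i, ih]

/-- Two `m`-cells `x`, `y` can be composed to `y ∘ₖ x`. -/
abbrev Composable {k m : ℕ} (h : k < m) (y x : A.cell m) : Prop :=
  A.tTo h.le x = A.sTo h.le y

variable {A}

theorem Composable.s {k m : ℕ} {h : k < m + 1} {y x : A.cell (m + 1)}
    (hc : A.Composable h y x) (h' : k < m) : A.Composable h' (A.s y) (A.s x) := by
  unfold Composable at *
  rw [A.tTo_s h', ← A.tTo_succ h'.le h.le, hc, A.sTo_succ h'.le h.le]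

theorem Composable.t {k m : ℕ} {h : k < m + 1} {y x : A.cell (m + 1)}
    (hc : A.Composable h y x) (h' : k < m) : A.Composable h' (A.t y) (A.t x) := by
  unfold Composable at *
  rw [A.sTo_t h', ← A.tTo_succ h'.le h.le, hc, A.sTo_succ h'.le h.le]

theorem Composable.i {k m : ℕ} {h : k < m} {y x : A.cell m}
    (hc : A.Composable h y x) (hm : m < n) :
    A.Composable (h.trans (Nat.lt_succ_self m)) (A.i hm y) (A.i hm x) := by
  unfold Composable at *
  rw [A.tTo_succ h.le, A.sTo_succ h.le, A.t_i, A.s_i, hc]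

/-- Parallel cells: any two `0`-cells, and higher cells with equal sources and equal targets. -/
def Parallel : ∀ {k : ℕ}, A.cell k → A.cell k → Prop
  | 0, _, _ => True
  | _ + 1, x, y => A.s x = A.s y ∧ A.t x = A.t y

end RGSet

/-- A map of reflexive globular sets. -/
@[ext]
structure RGHom {n : ℕ} (A B : RGSet.{u} n) where
  app : ∀ {k : ℕ}, A.cell k → B.cell k
  map_s : ∀ {k : ℕ} (x : A.cell (k + 1)), app (A.s x) = B.s (app x)
  map_t : ∀ {k : ℕ} (x : A.cell (k + 1)), app (A.t x) = B.t (app x)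
  map_i : ∀ {k : ℕ} (h : k < n) (x : A.cell k), app (A.i h x) = B.i h (app x)

namespace RGHom

variable {n : ℕ} {A B C : RGSet.{u} n}

/-- The identity map. -/
def id (A : RGSet.{u} n) : RGHom A A where
  app x := x
  map_s _ := rfl
  map_t _ := rfl
  map_i _ _ := rfl

/-- Composition of maps, in diagrammatic order. -/
def comp (f : RGHom A B) (g : RGHom B C) : RGHom A C where
  app x := g.app (f.app x)
  map_s x := by rw [f.map_s, g.map_s]
  map_t x := by rw [f.map_t, g.map_t]
  map_i h x := by rw [f.map_i, g.map_i]

theorem map_sTo (f : RGHom A B) {k m : ℕ} (h : k ≤ m) (x : A.cell m) :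
    f.app (A.sTo h x) = B.sTo h (f.app x) := by
  induction m, h using Nat.le_induction with
  | base => simp
  | succ m h ih => rw [A.sTo_succ h, B.sTo_succ h, ih, f.map_s]

theorem map_tTo (f : RGHom A B) {k m : ℕ} (h : k ≤ m) (x : A.cell m) :
    f.app (A.tTo h x) = B.tTo h (f.app x) := by
  induction m, h using Nat.le_induction with
  | base => simp
  | succ m h ih => rw [A.tTo_succ h, B.tTo_succ h, ih, f.map_t]

theorem map_iTo (f : RGHom A B) {k m : ℕ} (h : k ≤ m) (hm : m ≤ n) (x : A.cell k) :
    f.app (A.iTo h hm x) = B.iTo h hm (f.app x) := by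
  induction m, h using Nat.le_induction with
  | base => simp
  | succ m h ih => rw [A.iTo_succ h, B.iTo_succ h, f.map_i, ih]

theorem composable (f : RGHom A B) {k m : ℕ} {h : k < m} {y x : A.cell m}
    (hc : A.Composable h y x) : B.Composable h (f.app y) (f.app x) := by
  unfold RGSet.Composable at *
  rw [← f.map_tTo, ← f.map_sTo, hc]

theorem parallel (f : RGHom A B) {k : ℕ} {x y : A.cell k} (h : RGSet.Parallel x y) :
    RGSet.Parallel (f.app x) (f.app y) := by
  cases k with
  | zero => trivial
  | succ k => exact ⟨by rw [← f.map_s, h.1, f.map_s], by rw [← f.map_t, h.2, f.map_t]⟩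

end RGHom

/-- The category of `n`-dimensional reflexive globular sets. -/
instance (n : ℕ) : Category (RGSet.{u} n) where
  Hom := RGHom
  id := RGHom.id
  comp := RGHom.comp

/-! ### Magmas -/

/-- An `n`-dimensional magma: a reflexive globular set with a binary composition `y ∘ₖ x` of
`m`-cells along `k`-cells for all `k < m`. -/
structure Magma (n : ℕ) extends RGSet.{u} n where
  comp : ∀ {m : ℕ} (k : ℕ) (h : k < m) (y x : cell m), toRGSet.Composable h y x → cell m
  s_comp_top : ∀ {k : ℕ} (h : k < k + 1) (y x : cell (k + 1)) (hc : toRGSet.Composable h y x),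
    s (comp k h y x hc) = s x
  t_comp_top : ∀ {k : ℕ} (h : k < k + 1) (y x : cell (k + 1)) (hc : toRGSet.Composable h y x),
    t (comp k h y x hc) = t y
  s_comp : ∀ {k m : ℕ} (h : k < m + 1) (h' : k < m) (y x : cell (m + 1))
    (hc : toRGSet.Composable h y x),
    s (comp k h y x hc) = comp k h' (s y) (s x) (hc.s h')
  t_comp : ∀ {k m : ℕ} (h : k < m + 1) (h' : k < m) (y x : cell (m + 1))
    (hc : toRGSet.Composable h y x),
    t (comp k h y x hc) = comp k h' (t y) (t x) (hc.t h')

namespace Magma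

variable {n : ℕ} (M : Magma.{u} n)

theorem comp_congr {k m : ℕ} (h : k < m) {y y' x x' : M.cell m} (hy : y = y') (hx : x = x')
    (hc : M.Composable h y x) :
    M.comp k h y x hc = M.comp k h y' x' (hy ▸ hx ▸ hc) := by
  subst hy hx; rfl

theorem sTo_comp {k m : ℕ} (h : k < m) (y x : M.cell m) (hc : M.Composable h y x) :
    M.sTo h.le (M.comp k h y x hc) = M.sTo h.le x := by
  induction m, h using Nat.le_induction with
  | base => simp [M.s_comp_top]
  | succ m h' ih =>
    have h'' : k < m := h'
    rw [M.sTo_succ h''.le, M.sTo_succ h''.le, M.s_comp _ h'', ih]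

theorem tTo_comp {k m : ℕ} (h : k < m) (y x : M.cell m) (hc : M.Composable h y x) :
    M.tTo h.le (M.comp k h y x hc) = M.tTo h.le y := by
  induction m, h using Nat.le_induction with
  | base => simp [M.t_comp_top]
  | succ m h' ih =>
    have h'' : k < m := h'
    rw [M.tTo_succ h''.le, M.tTo_succ h''.le, M.t_comp _ h'', ih]

theorem composable_sTo {j k m : ℕ} (hj : j < k) (hk : k ≤ m) {y x : M.cell m}
    (hc : M.Composable (hj.trans_le hk) y x) : M.Composable hj (M.sTo hk y) (M.sTo hk x) := by
  unfold RGSet.Composable at *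
  rw [M.tTo_sTo hj, M.sTo_sTo, hc]

theorem composable_tTo {j k m : ℕ} (hj : j < k) (hk : k ≤ m) {y x : M.cell m}
    (hc : M.Composable (hj.trans_le hk) y x) : M.Composable hj (M.tTo hk y) (M.tTo hk x) := by
  unfold RGSet.Composable at *
  rw [M.sTo_tTo hj, M.tTo_tTo, hc]

theorem sTo_comp_lt {j k m : ℕ} (hj : j < k) (hk : k ≤ m) (y x : M.cell m)
    (hc : M.Composable (hj.trans_le hk) y x) :
    M.sTo hk (M.comp j (hj.trans_le hk) y x hc) =
      M.comp j hj (M.sTo hk y) (M.sTo hk x) (M.composable_sTo hj hk hc) := by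
  induction m, hk using Nat.le_induction with
  | base => simp
  | succ m h' ih =>
    rw [M.sTo_succ h', M.s_comp _ (hj.trans_le h'), ih]
    exact M.comp_congr _ (M.sTo_succ h' _ _).symm (M.sTo_succ h' _ _).symm _

theorem tTo_comp_lt {j k m : ℕ} (hj : j < k) (hk : k ≤ m) (y x : M.cell m)
    (hc : M.Composable (hj.trans_le hk) y x) :
    M.tTo hk (M.comp j (hj.trans_le hk) y x hc) =
      M.comp j hj (M.tTo hk y) (M.tTo hk x) (M.composable_tTo hj hk hc) := by
  induction m, hk using Nat.le_induction with
  | base => simp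
  | succ m h' ih =>
    rw [M.tTo_succ h', M.t_comp _ (hj.trans_le h'), ih]
    exact M.comp_congr _ (M.tTo_succ h' _ _).symm (M.tTo_succ h' _ _).symm _

variable {M}

/-! Side conditions under which the composites in the axioms of a strict `n`-category exist. -/

theorem composable_comp_left {k m : ℕ} {h : k < m} {z y x : M.cell m}
    (hzy : M.Composable h z y) (hyx : M.Composable h y x) :
    M.Composable h (M.comp k h z y hzy) x := by
  unfold RGSet.Composable at *
  rw [M.sTo_comp, hyx]

theorem composable_comp_right {k m : ℕ} {h : k < m} {z y x : M.cell m}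
    (hzy : M.Composable h z y) (hyx : M.Composable h y x) :
    M.Composable h z (M.comp k h y x hyx) := by
  unfold RGSet.Composable at *
  rw [M.tTo_comp, hzy]

theorem composable_interchange {j k m : ℕ} (hj : j < k) {hk : k < m} {w z y x : M.cell m}
    (hwz : M.Composable hk w z) (hyx : M.Composable hk y x)
    (hzx : M.Composable (hj.trans hk) z x) : M.Composable (hj.trans hk) w y := by
  unfold RGSet.Composable at *
  rw [← M.tTo_sTo hj hk.le y, ← hyx, M.tTo_tTo, hzx, ← M.sTo_tTo hj hk.le z, hwz, M.sTo_sTo]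

theorem composable_interchange_left {j k m : ℕ} (hj : j < k) {hk : k < m} {w z y x : M.cell m}
    (hwz : M.Composable hk w z) (hyx : M.Composable hk y x)
    (hzx : M.Composable (hj.trans hk) z x) :
    M.Composable (hj.trans hk) (M.comp k hk w z hwz) (M.comp k hk y x hyx) := by
  have hwy := composable_interchange hj hwz hyx hzx
  unfold RGSet.Composable at *
  rw [← M.tTo_tTo hj.le hk.le, M.tTo_comp, M.tTo_tTo, hwy, ← M.sTo_tTo hj hk.le (M.comp _ _ _ _ _),
    M.tTo_comp, M.sTo_tTo hj]

theorem composable_interchange_right {j k m : ℕ} (hj : j < k) {hk : k < m} {w z y x : M.cell m}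
    (hwz : M.Composable hk w z) (hyx : M.Composable hk y x)
    (hzx : M.Composable (hj.trans hk) z x) :
    M.Composable hk (M.comp j (hj.trans hk) w y (composable_interchange hj hwz hyx hzx))
      (M.comp j (hj.trans hk) z x hzx) := by
  unfold RGSet.Composable
  rw [M.tTo_comp_lt hj, M.sTo_comp_lt hj]
  exact M.comp_congr _ hwz hyx _

theorem composable_iTo_right {k m : ℕ} (h : k < m) (x : M.cell m) :
    M.Composable h x (M.iTo h.le (M.dim_le x) (M.sTo h.le x)) := by
  unfold RGSet.Composable
  rw [M.tTo_iTo]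

theorem composable_iTo_left {k m : ℕ} (h : k < m) (x : M.cell m) :
    M.Composable h (M.iTo h.le (M.dim_le x) (M.tTo h.le x)) x := by
  unfold RGSet.Composable
  rw [M.sTo_iTo]

theorem composable_top {k : ℕ} {y x : M.cell (k + 1)} (h : M.t x = M.s y) :
    M.Composable (Nat.lt_succ_self k) y x := by
  simpa [RGSet.Composable] using h

end Magma

/-- A map of magmas: a map of reflexive globular sets that preserves composition. -/
@[ext]
structure MagmaHom {n : ℕ} (M N : Magma.{u} n) extends RGHom M.toRGSet N.toRGSet where
  map_comp : ∀ {k m : ℕ} (h : k < m) (y x : M.cell m) (hc : M.Composable h y x),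
    app (M.comp k h y x hc) = N.comp k h (app y) (app x) (toRGHom.composable hc)

namespace MagmaHom

variable {n : ℕ} {M N K : Magma.{u} n}

/-- The identity map. -/
def id (M : Magma.{u} n) : MagmaHom M M where
  toRGHom := RGHom.id M.toRGSet
  map_comp _ _ _ _ := rfl

/-- Composition of maps of magmas, in diagrammatic order. -/
def comp (f : MagmaHom M N) (g : MagmaHom N K) : MagmaHom M K where
  toRGHom := f.toRGHom.comp g.toRGHom
  map_comp h y x hc := by
    change g.app (f.app _) = _
    rw [f.map_comp, g.map_comp]
    rfl

end MagmaHom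

/-! ### Strict `n`-categories -/

/-- A strict `n`-category, as a magma in which composition is associative, the cells picked out by
`i` are units, and interchange holds (for composites and for identities). -/
structure StrictCat (n : ℕ) extends Magma.{u} n where
  assoc : ∀ {k m : ℕ} (h : k < m) (z y x : cell m) (hzy : toRGSet.Composable h z y)
    (hyx : toRGSet.Composable h y x),
    comp k h (comp k h z y hzy) x (toMagma.composable_comp_left hzy hyx) =
      comp k h z (comp k h y x hyx) (toMagma.composable_comp_right hzy hyx)
  comp_id : ∀ {k m : ℕ} (h : k < m) (x : cell m),
    comp k h x (toRGSet.iTo h.le (toRGSet.dim_le x) (toRGSet.sTo h.le x))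
      (toMagma.composable_iTo_right h x) = x
  id_comp : ∀ {k m : ℕ} (h : k < m) (x : cell m),
    comp k h (toRGSet.iTo h.le (toRGSet.dim_le x) (toRGSet.tTo h.le x)) x
      (toMagma.composable_iTo_left h x) = x
  interchange : ∀ {j k m : ℕ} (hj : j < k) (hk : k < m) (w z y x : cell m)
    (hwz : toRGSet.Composable hk w z) (hyx : toRGSet.Composable hk y x)
    (hzx : toRGSet.Composable (hj.trans hk) z x),
    comp j (hj.trans hk) (comp k hk w z hwz) (comp k hk y x hyx)
        (toMagma.composable_interchange_left hj hwz hyx hzx) =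
      comp k hk (comp j (hj.trans hk) w y (toMagma.composable_interchange hj hwz hyx hzx))
        (comp j (hj.trans hk) z x hzx) (toMagma.composable_interchange_right hj hwz hyx hzx)
  i_comp : ∀ {k m : ℕ} (h : k < m) (hm : m < n) (y x : cell m)
    (hc : toRGSet.Composable h y x),
    i hm (comp k h y x hc) = comp k (h.trans (Nat.lt_succ_self m)) (i hm y) (i hm x) (hc.i hm)

/-! ### Contractions -/

/-- A contraction on a map of `n`-dimensional reflexive globular sets. -/
@[ext]
structure Contraction {n : ℕ} {A B : RGSet.{u} n} (f : RGHom A B) where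
  cell : ∀ {k : ℕ}, k < n → ∀ x y : A.cell k, RGSet.Parallel x y → f.app x = f.app y →
    A.cell (k + 1)
  s_cell : ∀ {k : ℕ} (hk : k < n) (x y : A.cell k) (hp : RGSet.Parallel x y)
    (hf : f.app x = f.app y), A.s (cell hk x y hp hf) = x
  t_cell : ∀ {k : ℕ} (hk : k < n) (x y : A.cell k) (hp : RGSet.Parallel x y)
    (hf : f.app x = f.app y), A.t (cell hk x y hp hf) = y
  map_cell : ∀ {k : ℕ} (hk : k < n) (x y : A.cell k) (hp : RGSet.Parallel x y)
    (hf : f.app x = f.app y), f.app (cell hk x y hp hf) = B.i hk (f.app x)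
  cell_self : ∀ {k : ℕ} (hk : k < n) (x : A.cell k) (hp : RGSet.Parallel x x)
    (hf : f.app x = f.app x), cell hk x x hp hf = A.i hk x
  eq_of_top : ∀ x y : A.cell n, RGSet.Parallel x y → f.app x = f.app y → x = y

theorem Contraction.cell_congr {n : ℕ} {A B : RGSet.{u} n} {f : RGHom A B} (c : Contraction f)
    {k : ℕ} (hk : k < n) {x x' y y' : A.cell k} (hx : x = x') (hy : y = y')
    (hp : RGSet.Parallel x y) (hf : f.app x = f.app y) :
    c.cell hk x y hp hf = c.cell hk x' y' (hx ▸ hy ▸ hp) (hx ▸ hy ▸ hf) := by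
  subst hx hy; rfl

/-! ### The category `𝒬` and its forgetful functor -/

/-- An object of `𝒬`: a magma `top`, a strict `n`-category `base`, a map of magmas `φ` between
them and a contraction on it. -/
structure QObj (n : ℕ) where
  top : Magma.{u} n
  base : StrictCat.{u} n
  φ : MagmaHom top base.toMagma
  con : Contraction φ.toRGHom

/-- A morphism of `𝒬`: a commuting square of maps of magmas that preserves contraction cells. -/
@[ext]
structure QHom {n : ℕ} (X Y : QObj.{u} n) where
  top : MagmaHom X.top Y.top
  base : MagmaHom X.base.toMagma Y.base.toMagma
  comm : ∀ {k : ℕ} (x : X.top.cell k), Y.φ.app (top.app x) = base.app (X.φ.app x)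
  map_con : ∀ {k : ℕ} (hk : k < n) (x y : X.top.cell k) (hp : RGSet.Parallel x y)
    (hf : X.φ.app x = X.φ.app y),
    top.app (X.con.cell hk x y hp hf) =
      Y.con.cell hk (top.app x) (top.app y) (top.parallel hp) (by rw [comm, comm, hf])

namespace QHom

variable {n : ℕ} {X Y Z : QObj.{u} n}

/-- The identity morphism. -/
def id (X : QObj.{u} n) : QHom X X where
  top := MagmaHom.id X.top
  base := MagmaHom.id X.base.toMagma
  comm _ := rfl
  map_con _ _ _ _ _ := rfl

/-- Composition of morphisms, in diagrammatic order. -/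
def comp (f : QHom X Y) (g : QHom Y Z) : QHom X Z where
  top := f.top.comp g.top
  base := f.base.comp g.base
  comm x := by
    change Z.φ.app (g.top.app (f.top.app x)) = g.base.app (f.base.app _)
    rw [g.comm, f.comm]
  map_con hk x y hp hf := by
    change g.top.app (f.top.app _) = _
    rw [f.map_con, g.map_con]
    rfl

end QHom

/-- The category `𝒬`. -/
instance (n : ℕ) : Category (QObj.{u} n) where
  Hom := QHom
  id := QHom.id
  comp := QHom.comp

/-- The forgetful functor `U : 𝒬 ⥤ RGSet`. -/
def forgetQ (n : ℕ) : QObj.{u} n ⥤ RGSet.{u} n where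
  obj X := X.top.toRGSet
  map f := f.top.toRGHom

/-! ### The left adjoint of the forgetful functor

The free object of `𝒬` on `A` consists of the formal expressions in the cells of `A`, built with all
the operations of an object of `𝒬`, that are defined under every interpretation; two expressions
are identified if they agree under every interpretation. -/

namespace QObj

variable {n : ℕ}

/-- The two magmas of an object of `𝒬`: `true` for the top one, `false` for the base. -/
def car (X : QObj.{u} n) : Bool → Magma.{u} n
  | true => X.top
  | false => X.base.toMagma

end QObj

/-- Formal expressions of dimension `k`, in the top magma (`true`) or in the base (`false`). -/
inductive Expr {n : ℕ} (A : RGSet.{u} n) : Bool → ℕ → Type u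
  | gen {k : ℕ} (a : A.cell k) : Expr A true k
  | s {b : Bool} {k : ℕ} (x : Expr A b (k + 1)) : Expr A b k
  | t {b : Bool} {k : ℕ} (x : Expr A b (k + 1)) : Expr A b k
  | i {b : Bool} {k : ℕ} (x : Expr A b k) : Expr A b (k + 1)
  | comp {b : Bool} {m : ℕ} (k : ℕ) (y x : Expr A b m) : Expr A b m
  | phi {k : ℕ} (x : Expr A true k) : Expr A false k
  | con {k : ℕ} (x y : Expr A true k) : Expr A true (k + 1)

/-- `Ev X g e v`: the expression `e` is defined in `X` under the interpretation `g` of the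
generators, with value `v`. -/
inductive Ev {n : ℕ} {A : RGSet.{u} n} (X : QObj.{u} n) (g : RGHom A X.top.toRGSet) :
    ∀ {b : Bool} {k : ℕ}, Expr A b k → (X.car b).cell k → Prop
  | gen {k : ℕ} (a : A.cell k) : Ev X g (.gen a) (g.app a : X.top.cell k)
  | s {b : Bool} {k : ℕ} {x : Expr A b (k + 1)} {v : (X.car b).cell (k + 1)} (h : Ev X g x v) :
      Ev X g (.s x) ((X.car b).s v)
  | t {b : Bool} {k : ℕ} {x : Expr A b (k + 1)} {v : (X.car b).cell (k + 1)} (h : Ev X g x v) :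
      Ev X g (.t x) ((X.car b).t v)
  | i {b : Bool} {k : ℕ} {x : Expr A b k} {v : (X.car b).cell k} (hk : k < n) (h : Ev X g x v) :
      Ev X g (.i x) ((X.car b).i hk v)
  | comp {b : Bool} {k m : ℕ} {y x : Expr A b m} {w v : (X.car b).cell m} (hk : k < m)
      (hy : Ev X g y w) (hx : Ev X g x v) (hc : (X.car b).Composable hk w v) :
      Ev X g (.comp k y x) ((X.car b).comp k hk w v hc)
  | phi {k : ℕ} {x : Expr A true k} {v : X.top.cell k} (h : Ev X g x v) :
      Ev X g (.phi x) (X.φ.app v : X.base.cell k)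
  | con {k : ℕ} {x y : Expr A true k} {v w : X.top.cell k} (hk : k < n) (hx : Ev X g x v)
      (hy : Ev X g y w) (hp : RGSet.Parallel v w) (hf : X.φ.app v = X.φ.app w) :
      Ev X g (.con x y) (X.con.cell hk v w hp hf : X.top.cell (k + 1))

theorem Ev.unique {n : ℕ} {A : RGSet.{u} n} {X : QObj.{u} n} {g : RGHom A X.top.toRGSet}
    {b : Bool} {k : ℕ} {e : Expr A b k} {v w : (X.car b).cell k} (hv : Ev X g e v)
    (hw : Ev X g e w) : v = w := by
  induction hv with
  | gen a => cases hw; rfl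
  | s _ ih => cases hw with | s h => rw [ih h]
  | t _ ih => cases hw with | t h => rw [ih h]
  | i _ _ ih => cases hw with | i _ h => rw [ih h]
  | comp _ _ _ _ ihy ihx =>
    cases hw with
    | comp _ hy hx _ => obtain rfl := ihy hy; obtain rfl := ihx hx; rfl
  | phi _ ih => cases hw with | phi h => rw [ih h]
  | con _ _ _ _ _ ihx ihy =>
    cases hw with
    | con _ hx hy _ _ => obtain rfl := ihx hx; obtain rfl := ihy hy; rfl

section Free

variable {n : ℕ} (A : RGSet.{u} n)

/-- The expressions of dimension at most `n` that are defined under every interpretation. -/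
def DefExpr (b : Bool) (k : ℕ) : Type u :=
  { e : Expr A b k // k ≤ n ∧
    ∀ (X : QObj.{u} n) (g : RGHom A X.top.toRGSet), ∃ v, Ev X g e v }

/-- Expressions are identified if they agree under every interpretation. -/
def defExprSetoid (b : Bool) (k : ℕ) : Setoid (DefExpr A b k) where
  r e e' := ∀ (X : QObj.{u} n) (g : RGHom A X.top.toRGSet) (v : (X.car b).cell k),
    Ev X g e.1 v ↔ Ev X g e'.1 v
  iseqv := ⟨fun _ _ _ _ => Iff.rfl, fun h X g v => (h X g v).symm,
    fun h h' X g v => (h X g v).trans (h' X g v)⟩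

/-- The cells of the free object. -/
def FreeCell (b : Bool) (k : ℕ) : Type u := Quotient (defExprSetoid A b k)

variable {A}

/-- The class of an expression. -/
def FreeCell.mk {b : Bool} {k : ℕ} (e : Expr A b k) (hk : k ≤ n)
    (h : ∀ (X : QObj.{u} n) (g : RGHom A X.top.toRGSet), ∃ v, Ev X g e v) : FreeCell A b k :=
  Quotient.mk (defExprSetoid A b k) ⟨e, hk, h⟩

/-- An expression representing a cell of the free object. -/
noncomputable def FreeCell.rep {b : Bool} {k : ℕ} (q : FreeCell A b k) : DefExpr A b k :=
  @Quotient.out _ (defExprSetoid A b k) q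

/-- The value of a cell of the free object under an interpretation. -/
noncomputable def FreeCell.val {b : Bool} {k : ℕ} (X : QObj.{u} n) (g : RGHom A X.top.toRGSet)
    (q : FreeCell A b k) : (X.car b).cell k :=
  (q.rep.2.2 X g).choose

namespace FreeCell

variable {b : Bool} {k : ℕ}

theorem dim_le (q : FreeCell A b k) : k ≤ n := q.rep.2.1

theorem ev_rep (X : QObj.{u} n) (g : RGHom A X.top.toRGSet) (q : FreeCell A b k) :
    Ev X g q.rep.1 (q.val X g) :=
  (q.rep.2.2 X g).choose_spec

theorem mk_rep (q : FreeCell A b k) : mk q.rep.1 q.rep.2.1 q.rep.2.2 = q :=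
  @Quotient.out_eq _ (defExprSetoid A b k) q

theorem ext' {q q' : FreeCell A b k}
    (h : ∀ (X : QObj.{u} n) (g : RGHom A X.top.toRGSet), q.val X g = q'.val X g) : q = q' := by
  rw [← mk_rep q, ← mk_rep q']
  refine Quotient.sound (s := defExprSetoid A b k) fun X g v => ⟨fun hv => ?_, fun hv => ?_⟩
  · rw [hv.unique (q.ev_rep X g), h]; exact q'.ev_rep X g
  · rw [hv.unique (q'.ev_rep X g), ← h]; exact q.ev_rep X g

theorem val_mk {X : QObj.{u} n} {g : RGHom A X.top.toRGSet} {e : Expr A b k} {hk : k ≤ n}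
    {h : ∀ (X : QObj.{u} n) (g : RGHom A X.top.toRGSet), ∃ v, Ev X g e v}
    {v : (X.car b).cell k} (hv : Ev X g e v) : (mk e hk h).val X g = v := by
  have h1 := Quotient.exact (s := defExprSetoid A b k) (mk_rep (mk e hk h))
  exact ((h1 X g _).1 ((mk e hk h).ev_rep X g)).unique hv

end FreeCell

attribute [irreducible] FreeCell.mk FreeCell.val FreeCell.rep

open FreeCell

variable (A)

/-- The underlying reflexive globular sets of the free object. -/
noncomputable def freeRG (b : Bool) : RGSet.{u} n where
  cell k := FreeCell A b k
  isEmpty_cell k hk := ⟨fun q => absurd q.dim_le (not_le.2 hk)⟩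
  s q := mk (.s q.rep.1) (Nat.le_of_succ_le q.dim_le) fun X g => ⟨_, .s (q.ev_rep X g)⟩
  t q := mk (.t q.rep.1) (Nat.le_of_succ_le q.dim_le) fun X g => ⟨_, .t (q.ev_rep X g)⟩
  i hk q := mk (.i q.rep.1) hk fun X g => ⟨_, .i hk (q.ev_rep X g)⟩
  s_s q := ext' fun X g => by
    rw [val_mk (.s (ev_rep X g _)), val_mk (.s (ev_rep X g _)), val_mk (.s (ev_rep X g _)),
      val_mk (.t (ev_rep X g _)), RGSet.s_s]
  t_s q := ext' fun X g => by
    rw [val_mk (.t (ev_rep X g _)), val_mk (.s (ev_rep X g _)), val_mk (.t (ev_rep X g _)),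
      val_mk (.t (ev_rep X g _)), RGSet.t_s]
  s_i hk q := ext' fun X g => by
    rw [val_mk (.s (ev_rep X g _)), val_mk (.i hk (ev_rep X g _)), RGSet.s_i]
  t_i hk q := ext' fun X g => by
    rw [val_mk (.t (ev_rep X g _)), val_mk (.i hk (ev_rep X g _)), RGSet.t_i]

variable {A}

/-- Evaluation of the cells of the free object. -/
noncomputable def valRG (X : QObj.{u} n) (g : RGHom A X.top.toRGSet) (b : Bool) :
    RGHom (freeRG A b) (X.car b).toRGSet where
  app q := FreeCell.val X g q
  map_s q := val_mk (.s (ev_rep X g q))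
  map_t q := val_mk (.t (ev_rep X g q))
  map_i hk q := val_mk (.i hk (ev_rep X g q))

theorem freeRG_ext {b : Bool} {k : ℕ} {q q' : (freeRG A b).cell k}
    (h : ∀ (X : QObj.{u} n) (g : RGHom A X.top.toRGSet),
      (valRG X g b).app q = (valRG X g b).app q') : q = q' :=
  ext' h

/-- Composition in the free object. -/
noncomputable def freeComp {b : Bool} {m : ℕ} (k : ℕ) (h : k < m) (y x : (freeRG A b).cell m)
    (hc : (freeRG A b).Composable h y x) : (freeRG A b).cell m :=
  FreeCell.mk (.comp k (rep y).1 (rep x).1) ((freeRG A b).dim_le x) fun X g =>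
    ⟨_, .comp h (ev_rep X g y) (ev_rep X g x) ((valRG X g b).composable hc)⟩

theorem val_freeComp (X : QObj.{u} n) (g : RGHom A X.top.toRGSet) {b : Bool} {m : ℕ} (k : ℕ)
    (h : k < m) (y x : (freeRG A b).cell m) (hc : (freeRG A b).Composable h y x) :
    (valRG X g b).app (freeComp k h y x hc) =
      (X.car b).comp k h ((valRG X g b).app y) ((valRG X g b).app x)
        ((valRG X g b).composable hc) :=
  val_mk (.comp h (ev_rep X g y) (ev_rep X g x) ((valRG X g b).composable hc))

variable (A)

/-- The magmas of the free object. -/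
noncomputable def freeMagma (b : Bool) : Magma.{u} n where
  toRGSet := freeRG A b
  comp k h y x hc := freeComp k h y x hc
  s_comp_top h y x hc := freeRG_ext fun X g => by
    rw [RGHom.map_s, val_freeComp, RGHom.map_s, Magma.s_comp_top]
  t_comp_top h y x hc := freeRG_ext fun X g => by
    rw [RGHom.map_t, val_freeComp, RGHom.map_t, Magma.t_comp_top]
  s_comp h h' y x hc := freeRG_ext fun X g => by
    rw [RGHom.map_s, val_freeComp, val_freeComp, Magma.s_comp _ _ h']
    exact Magma.comp_congr _ _ (RGHom.map_s _ _).symm (RGHom.map_s _ _).symm _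
  t_comp h h' y x hc := freeRG_ext fun X g => by
    rw [RGHom.map_t, val_freeComp, val_freeComp, Magma.t_comp _ _ h']
    exact Magma.comp_congr _ _ (RGHom.map_t _ _).symm (RGHom.map_t _ _).symm _

variable {A}

/-- Evaluation as a map of magmas. -/
noncomputable def valMagma (X : QObj.{u} n) (g : RGHom A X.top.toRGSet) (b : Bool) :
    MagmaHom (freeMagma A b) (X.car b) where
  toRGHom := valRG X g b
  map_comp h y x hc := val_freeComp X g _ h y x hc

theorem freeMagma_ext {b : Bool} {k : ℕ} {q q' : (freeMagma A b).cell k}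
    (h : ∀ (X : QObj.{u} n) (g : RGHom A X.top.toRGSet),
      (valMagma X g b).app q = (valMagma X g b).app q') : q = q' :=
  ext' h

variable (A)

/-- The base of the free object. -/
noncomputable def freeBase : StrictCat.{u} n where
  toMagma := freeMagma A false
  assoc h z y x hzy hyx := freeMagma_ext fun X g => by
    simp only [MagmaHom.map_comp]
    exact X.base.assoc h _ _ _ _ _
  comp_id h x := freeMagma_ext fun X g => by
    simp only [MagmaHom.map_comp]
    refine Eq.trans ?_ (X.base.comp_id h _)
    refine Magma.comp_congr _ _ rfl ?_ _
    rw [RGHom.map_iTo, RGHom.map_sTo]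
    rfl
  id_comp h x := freeMagma_ext fun X g => by
    simp only [MagmaHom.map_comp]
    refine Eq.trans ?_ (X.base.id_comp h _)
    refine Magma.comp_congr _ _ ?_ rfl _
    rw [RGHom.map_iTo, RGHom.map_tTo]
    rfl
  interchange hj hk w z y x hwz hyx hzx := freeMagma_ext fun X g => by
    simp only [MagmaHom.map_comp]
    exact X.base.interchange hj hk _ _ _ _ _ _ _
  i_comp h hm y x hc := freeMagma_ext fun X g => by
    rw [RGHom.map_i, MagmaHom.map_comp, MagmaHom.map_comp]
    refine (X.base.i_comp h hm _ _ _).trans ?_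
    exact Magma.comp_congr _ _ (RGHom.map_i _ _ _).symm (RGHom.map_i _ _ _).symm _

/-- The map from the top magma of the free object to its base. -/
noncomputable def freePhi : MagmaHom (freeMagma A true) (freeMagma A false) where
  app q := FreeCell.mk (.phi (rep q).1) ((freeRG A true).dim_le q) fun X g =>
    ⟨_, .phi (ev_rep X g q)⟩
  map_s q := freeMagma_ext fun X g => by
    refine Eq.trans ?_ ((valMagma X g false).map_s _).symm
    refine (val_mk (.phi (ev_rep X g _))).trans ?_
    refine Eq.trans ?_ (congrArg (RGSet.s _) (val_mk (.phi (ev_rep X g _))).symm)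
    exact (congrArg X.φ.app ((valMagma X g true).map_s q)).trans (X.φ.map_s _)
  map_t q := freeMagma_ext fun X g => by
    refine Eq.trans ?_ ((valMagma X g false).map_t _).symm
    refine (val_mk (.phi (ev_rep X g _))).trans ?_
    refine Eq.trans ?_ (congrArg (RGSet.t _) (val_mk (.phi (ev_rep X g _))).symm)
    exact (congrArg X.φ.app ((valMagma X g true).map_t q)).trans (X.φ.map_t _)
  map_i hk q := freeMagma_ext fun X g => by
    refine Eq.trans ?_ ((valMagma X g false).map_i hk _).symm
    refine (val_mk (.phi (ev_rep X g _))).trans ?_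
    refine Eq.trans ?_ (congrArg (RGSet.i _ hk) (val_mk (.phi (ev_rep X g _))).symm)
    exact (congrArg X.φ.app ((valMagma X g true).map_i hk q)).trans (X.φ.map_i hk _)
  map_comp h y x hc := freeMagma_ext fun X g => by
    refine Eq.trans ?_ ((valMagma X g false).map_comp h _ _ _).symm
    refine (val_mk (.phi (ev_rep X g _))).trans ?_
    refine (congrArg X.φ.app ((valMagma X g true).map_comp h y x hc)).trans ?_
    refine (X.φ.map_comp h _ _ _).trans ?_
    exact Magma.comp_congr _ _ (val_mk (.phi (ev_rep X g _))).symm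
      (val_mk (.phi (ev_rep X g _))).symm _

variable {A}

theorem val_freePhi (X : QObj.{u} n) (g : RGHom A X.top.toRGSet) {k : ℕ}
    (q : (freeMagma A true).cell k) :
    (valMagma X g false).app ((freePhi A).app q) = X.φ.app ((valMagma X g true).app q) :=
  val_mk (.phi (ev_rep X g _))

theorem val_phi_eq (X : QObj.{u} n) (g : RGHom A X.top.toRGSet) {k : ℕ}
    {x y : (freeMagma A true).cell k} (h : (freePhi A).app x = (freePhi A).app y) :
    X.φ.app ((valMagma X g true).app x) = X.φ.app ((valMagma X g true).app y) := by
  rw [← val_freePhi, h, val_freePhi]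

/-- Contraction cells of the free object. -/
noncomputable def freeConCell {k : ℕ} (hk : k < n) (x y : (freeMagma A true).cell k)
    (hp : RGSet.Parallel x y) (hf : (freePhi A).app x = (freePhi A).app y) :
    (freeMagma A true).cell (k + 1) :=
  FreeCell.mk (.con (rep x).1 (rep y).1) hk fun X g =>
    ⟨_, .con hk (ev_rep X g x) (ev_rep X g y) ((valMagma X g true).parallel hp)
      (val_phi_eq X g hf)⟩

theorem val_freeConCell (X : QObj.{u} n) (g : RGHom A X.top.toRGSet) {k : ℕ} (hk : k < n)
    (x y : (freeMagma A true).cell k) (hp : RGSet.Parallel x y)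
    (hf : (freePhi A).app x = (freePhi A).app y) :
    (valMagma X g true).app (freeConCell hk x y hp hf) =
      X.con.cell hk ((valMagma X g true).app x) ((valMagma X g true).app y)
        ((valMagma X g true).parallel hp) (val_phi_eq X g hf) :=
  val_mk (.con hk (ev_rep X g x) (ev_rep X g y) ((valMagma X g true).parallel hp)
      (val_phi_eq X g hf))

variable (A)

/-- The free object of `𝒬` on a reflexive globular set. -/
noncomputable def freeQ : QObj.{u} n where
  top := freeMagma A true
  base := freeBase A
  φ := freePhi A
  con :=
    { cell := fun hk x y hp hf => freeConCell hk x y hp hf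
      s_cell := fun hk x y hp hf => freeMagma_ext fun X g => by
        exact ((valMagma X g true).map_s _).trans
          ((congrArg X.top.s (val_freeConCell X g hk x y hp hf)).trans (X.con.s_cell hk _ _ _ _))
      t_cell := fun hk x y hp hf => freeMagma_ext fun X g => by
        exact ((valMagma X g true).map_t _).trans
          ((congrArg X.top.t (val_freeConCell X g hk x y hp hf)).trans (X.con.t_cell hk _ _ _ _))
      map_cell := fun hk x y hp hf => freeMagma_ext fun X g => by
        refine (val_freePhi X g _).trans ?_
        refine (congrArg X.φ.app (val_freeConCell X g hk x y hp hf)).trans ?_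
        refine (X.con.map_cell hk _ _ _ _).trans ?_
        refine Eq.trans ?_ ((valMagma X g false).map_i hk _).symm
        exact congrArg (X.base.i hk) (val_freePhi X g x).symm
      cell_self := fun hk x hp hf => freeMagma_ext fun X g => by
        exact (val_freeConCell X g hk x x hp hf).trans
          ((X.con.cell_self hk _ _ _).trans ((valMagma X g true).map_i hk x).symm)
      eq_of_top := fun x y hp hf => freeMagma_ext fun X g =>
        X.con.eq_of_top _ _ ((valMagma X g true).parallel hp) (val_phi_eq X g hf) }

/-- The inclusion of generators. -/
def freeUnit : A ⟶ (forgetQ n).obj (freeQ A) where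
  app a := FreeCell.mk (.gen a) (A.dim_le a) fun X g => ⟨_, .gen a⟩
  map_s a := freeMagma_ext fun X g => by
    refine Eq.trans ?_ ((valMagma X g true).map_s _).symm
    refine (val_mk (.gen _)).trans ((g.map_s a).trans ?_)
    exact congrArg X.top.s (val_mk (.gen a)).symm
  map_t a := freeMagma_ext fun X g => by
    refine Eq.trans ?_ ((valMagma X g true).map_t _).symm
    refine (val_mk (.gen _)).trans ((g.map_t a).trans ?_)
    exact congrArg X.top.t (val_mk (.gen a)).symm
  map_i hk a := freeMagma_ext fun X g => by
    refine Eq.trans ?_ ((valMagma X g true).map_i hk _).symm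
    refine (val_mk (.gen _)).trans ((g.map_i hk a).trans ?_)
    exact congrArg (X.top.i hk) (val_mk (.gen a)).symm

variable {A}

/-- The morphism out of the free object induced by an interpretation of the generators. -/
noncomputable def freeLift (X : QObj.{u} n) (g : A ⟶ (forgetQ n).obj X) : freeQ A ⟶ X where
  top := valMagma X g true
  base := valMagma X g false
  comm q := (val_freePhi X g q).symm
  map_con hk x y hp hf := val_freeConCell X g hk x y hp hf

theorem freeUnit_lift (X : QObj.{u} n) (g : A ⟶ (forgetQ n).obj X) :
    freeUnit A ≫ (forgetQ n).map (freeLift X g) = g := by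
  apply RGHom.ext
  funext k a
  exact val_mk (.gen a)

/-- The components of a morphism of `𝒬` out of the free object. -/
def freeCar {X : QObj.{u} n} (f : QHom (freeQ A) X) :
    ∀ b : Bool, MagmaHom (freeMagma A b) (X.car b)
  | true => f.top
  | false => f.base

theorem freeCar_eq (X : QObj.{u} n) (f : freeQ A ⟶ X) (g : A ⟶ (forgetQ n).obj X)
    (hf : freeUnit A ≫ (forgetQ n).map f = g) {b : Bool} {k : ℕ} (e : Expr A b k) (hk : k ≤ n)
    (h : ∀ (X : QObj.{u} n) (g : RGHom A X.top.toRGSet), ∃ v, Ev X g e v) :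
    (freeCar f b).app (FreeCell.mk e hk h) = (valMagma X g b).app (FreeCell.mk e hk h) := by
  induction e with
  | gen a =>
    subst hf
    refine Eq.trans ?_ (val_mk (g := freeUnit A ≫ (forgetQ n).map f) (.gen a)).symm
    rfl
  | @s b k x ih =>
    have h' : ∀ (X : QObj.{u} n) (g : RGHom A X.top.toRGSet), ∃ v, Ev X g x v := fun X g => by
      obtain ⟨v, hv⟩ := h X g
      cases hv with | s hv => exact ⟨_, hv⟩
    have hk' : k + 1 ≤ n := (X.car b).dim_le (h' X g).choose
    have e : (FreeCell.mk (.s x) hk h : (freeMagma A b).cell k) =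
        (freeMagma A b).s (FreeCell.mk x hk' h') := freeMagma_ext fun X g => by
      obtain ⟨v, hv⟩ := h' X g
      refine (val_mk (.s hv)).trans (Eq.trans ?_ ((valMagma X g b).map_s _).symm)
      exact congrArg (X.car b).s (val_mk hv).symm
    rw [e]
    exact ((freeCar f b).map_s _).trans
      ((congrArg (X.car b).s (ih hk' h')).trans ((valMagma X g b).map_s _).symm)
  | @t b k x ih =>
    have h' : ∀ (X : QObj.{u} n) (g : RGHom A X.top.toRGSet), ∃ v, Ev X g x v := fun X g => by
      obtain ⟨v, hv⟩ := h X g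
      cases hv with | t hv => exact ⟨_, hv⟩
    have hk' : k + 1 ≤ n := (X.car b).dim_le (h' X g).choose
    have e : (FreeCell.mk (.t x) hk h : (freeMagma A b).cell k) =
        (freeMagma A b).t (FreeCell.mk x hk' h') := freeMagma_ext fun X g => by
      obtain ⟨v, hv⟩ := h' X g
      refine (val_mk (.t hv)).trans (Eq.trans ?_ ((valMagma X g b).map_t _).symm)
      exact congrArg (X.car b).t (val_mk hv).symm
    rw [e]
    exact ((freeCar f b).map_t _).trans
      ((congrArg (X.car b).t (ih hk' h')).trans ((valMagma X g b).map_t _).symm)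
  | @i b k x ih =>
    have h' : ∀ (X : QObj.{u} n) (g : RGHom A X.top.toRGSet), ∃ v, Ev X g x v := fun X g => by
      obtain ⟨v, hv⟩ := h X g
      cases hv with | i _ hv => exact ⟨_, hv⟩
    have e : (FreeCell.mk (.i x) hk h : (freeMagma A b).cell (k + 1)) =
        (freeMagma A b).i hk (FreeCell.mk x (Nat.le_of_succ_le hk) h') :=
      freeMagma_ext fun X g => by
        obtain ⟨v, hv⟩ := h' X g
        refine (val_mk (.i hk hv)).trans (Eq.trans ?_ ((valMagma X g b).map_i hk _).symm)
        exact congrArg ((X.car b).i hk) (val_mk hv).symm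
    rw [e]
    exact ((freeCar f b).map_i hk _).trans
      ((congrArg ((X.car b).i hk) (ih _ h')).trans ((valMagma X g b).map_i hk _).symm)
  | @comp b m k y x ihy ihx =>
    have hy : ∀ (X : QObj.{u} n) (g : RGHom A X.top.toRGSet), ∃ v, Ev X g y v := fun X g => by
      obtain ⟨v, hv⟩ := h X g
      cases hv with | comp _ hv _ _ => exact ⟨_, hv⟩
    have hx : ∀ (X : QObj.{u} n) (g : RGHom A X.top.toRGSet), ∃ v, Ev X g x v := fun X g => by
      obtain ⟨v, hv⟩ := h X g
      cases hv with | comp _ _ hv _ => exact ⟨_, hv⟩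
    have hkm : k < m := by
      obtain ⟨v, hv⟩ := h (freeQ A) (freeUnit A)
      cases hv with | comp h _ _ _ => exact h
    have hc : (freeMagma A b).Composable hkm (FreeCell.mk y hk hy) (FreeCell.mk x hk hx) :=
      freeMagma_ext fun X g => by
        obtain ⟨v, hv⟩ := h X g
        cases hv with
        | comp _ hy' hx' hc =>
          refine ((valMagma X g b).map_tTo _ _).trans
            (Eq.trans ?_ ((valMagma X g b).map_sTo _ _).symm)
          refine (congrArg ((X.car b).tTo hkm.le) (val_mk hx')).trans (hc.trans ?_)
          exact congrArg ((X.car b).sTo hkm.le) (val_mk hy').symm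
    have e : (FreeCell.mk (.comp k y x) hk h : (freeMagma A b).cell m) =
        (freeMagma A b).comp k hkm (FreeCell.mk y hk hy) (FreeCell.mk x hk hx) hc :=
      freeMagma_ext fun X g => by
        obtain ⟨v, hv⟩ := h X g
        cases hv with
        | comp _ hy' hx' hc =>
          refine (val_mk (.comp hkm hy' hx' hc)).trans
            (Eq.trans ?_ ((valMagma X g b).map_comp hkm _ _ _).symm)
          exact Magma.comp_congr _ _ (val_mk hy').symm (val_mk hx').symm _
    rw [e]
    exact ((freeCar f b).map_comp hkm _ _ _).trans
      ((Magma.comp_congr _ _ (ihy hk hy) (ihx hk hx) _).trans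
        ((valMagma X g b).map_comp hkm _ _ _).symm)
  | @phi k x ih =>
    have h' : ∀ (X : QObj.{u} n) (g : RGHom A X.top.toRGSet), ∃ v, Ev X g x v := fun X g => by
      obtain ⟨v, hv⟩ := h X g
      cases hv with | phi hv => exact ⟨_, hv⟩
    have e : (FreeCell.mk (.phi x) hk h : (freeMagma A false).cell k) =
        (freePhi A).app (FreeCell.mk x hk h') := freeMagma_ext fun X g => by
      obtain ⟨v, hv⟩ := h' X g
      refine (val_mk (.phi hv)).trans (Eq.trans ?_ (val_freePhi X g _).symm)
      exact congrArg X.φ.app (val_mk hv).symm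
    rw [e]
    exact (QHom.comm f _).symm.trans
      ((congrArg X.φ.app (ih hk h')).trans (val_freePhi X g _).symm)
  | @con k x y ihx ihy =>
    have hx : ∀ (X : QObj.{u} n) (g : RGHom A X.top.toRGSet), ∃ v, Ev X g x v := fun X g => by
      obtain ⟨v, hv⟩ := h X g
      cases hv with | con _ hv _ _ _ => exact ⟨_, hv⟩
    have hy : ∀ (X : QObj.{u} n) (g : RGHom A X.top.toRGSet), ∃ v, Ev X g y v := fun X g => by
      obtain ⟨v, hv⟩ := h X g
      cases hv with | con _ _ hv _ _ => exact ⟨_, hv⟩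
    have hk' := Nat.le_of_succ_le hk
    have hp : RGSet.Parallel (A := (freeMagma A true).toRGSet) (FreeCell.mk x hk' hx)
        (FreeCell.mk y hk' hy) := by
      cases k with
      | zero => trivial
      | succ k =>
        refine ⟨freeMagma_ext fun X g => ?_, freeMagma_ext fun X g => ?_⟩
        · obtain ⟨v, hv⟩ := h X g
          cases hv with
          | con _ hx' hy' hp _ =>
            refine ((valMagma X g true).map_s _).trans
              (Eq.trans ?_ ((valMagma X g true).map_s _).symm)
            refine (congrArg (X.car true).s (val_mk hx')).trans (hp.1.trans ?_)
            exact congrArg (X.car true).s (val_mk hy').symm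
        · obtain ⟨v, hv⟩ := h X g
          cases hv with
          | con _ hx' hy' hp _ =>
            refine ((valMagma X g true).map_t _).trans
              (Eq.trans ?_ ((valMagma X g true).map_t _).symm)
            refine (congrArg (X.car true).t (val_mk hx')).trans (hp.2.trans ?_)
            exact congrArg (X.car true).t (val_mk hy').symm
    have hf' : (freePhi A).app (FreeCell.mk x hk' hx) = (freePhi A).app (FreeCell.mk y hk' hy) :=
      freeMagma_ext fun X g => by
        obtain ⟨v, hv⟩ := h X g
        cases hv with
        | con _ hx' hy' _ hq =>
          refine (val_freePhi X g _).trans (Eq.trans ?_ (val_freePhi X g _).symm)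
          refine (congrArg X.φ.app (val_mk hx')).trans (hq.trans ?_)
          exact congrArg X.φ.app (val_mk hy').symm
    have e : (FreeCell.mk (.con x y) hk h : (freeMagma A true).cell (k + 1)) =
        freeConCell hk (FreeCell.mk x hk' hx) (FreeCell.mk y hk' hy) hp hf' :=
      freeMagma_ext fun X g => by
        obtain ⟨v, hv⟩ := h X g
        cases hv with
        | con _ hx' hy' hp hq =>
          refine (val_mk (.con hk hx' hy' hp hq)).trans
            (Eq.trans ?_ (val_freeConCell X g hk _ _ _ _).symm)
          exact X.con.cell_congr hk (val_mk hx').symm (val_mk hy').symm _ _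
    rw [e]
    exact (QHom.map_con f hk _ _ hp hf').trans
      ((X.con.cell_congr hk (ihx hk' hx) (ihy hk' hy) _ _).trans
        (val_freeConCell X g hk _ _ hp hf').symm)

theorem freeLift_unique (X : QObj.{u} n) (f : freeQ A ⟶ X) (g : A ⟶ (forgetQ n).obj X)
    (hf : freeUnit A ≫ (forgetQ n).map f = g) : freeLift X g = f := by
  have key : ∀ (b : Bool) {k : ℕ} (q : (freeMagma A b).cell k),
      (freeCar f b).app q = (valMagma X g b).app q := fun b k q => by
    rw [← FreeCell.mk_rep q]
    exact freeCar_eq X f g hf _ _ _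
  apply QHom.ext
  · apply MagmaHom.ext
    funext k q
    exact (key true q).symm
  · apply MagmaHom.ext
    funext k q
    exact (key false q).symm

/-- The universal property of the free object. -/
noncomputable def freeEquiv (A : RGSet.{u} n) (X : QObj.{u} n) :
    (freeQ A ⟶ X) ≃ (A ⟶ (forgetQ n).obj X) where
  toFun f := freeUnit A ≫ (forgetQ n).map f
  invFun g := freeLift X g
  left_inv f := freeLift_unique X f _ rfl
  right_inv g := freeUnit_lift X g

end Free

/-- The free functor `F : RGSet ⥤ 𝒬`. -/
noncomputable def freeFunctor (n : ℕ) : RGSet.{u} n ⥤ QObj.{u} n :=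
  Adjunction.leftAdjointOfEquiv (G := forgetQ n) (F_obj := freeQ) freeEquiv
    fun A X Y g h => by simp [freeEquiv]

/-- The adjunction `F ⊣ U`. -/
noncomputable def freeAdj (n : ℕ) : freeFunctor.{u} n ⊣ forgetQ.{u} n :=
  Adjunction.adjunctionOfEquivLeft freeEquiv _

/-- The monad `Pₙ` on `n`-dimensional reflexive globular sets. -/
noncomputable def penonMonad (n : ℕ) : Monad (RGSet.{u} n) := (freeAdj n).toMonad

/-- A Penon `n`-category is an algebra for the monad `Pₙ`. -/
abbrev PenonCat (n : ℕ) : Type (u + 1) := (penonMonad.{u} n).Algebra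

/-! ### Penon `n`-categories -/

section Algebra

variable {n : ℕ} (A : PenonCat.{u} n)

/-- The free object `φ : PA → T_R A` of `𝒬` on the underlying reflexive globular set of `A`; its top
magma has underlying reflexive globular set `PA`. -/
noncomputable def freeOn : QObj.{u} n := (freeFunctor n).obj A.A

/-- The unit `η : A → PA`. -/
noncomputable def unitMap : RGHom A.A (freeOn A).top.toRGSet := (penonMonad n).η.app A.A

/-- The algebra structure `θ : PA → A`. -/
def actMap : RGHom (freeOn A).top.toRGSet A.A := A.a

/-- Composition in the Penon `n`-category `A`: the formal composite in `PA`, evaluated by `θ`. -/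
noncomputable def compA {m : ℕ} (k : ℕ) (h : k < m) (y x : A.A.cell m)
    (hc : A.A.Composable h y x) : A.A.cell m :=
  (actMap A).app
    ((freeOn A).top.comp k h ((unitMap A).app y) ((unitMap A).app x) ((unitMap A).composable hc))

variable {A}

theorem act_unit {k : ℕ} (x : A.A.cell k) : (actMap A).app ((unitMap A).app x) = x :=
  congrArg (fun f : RGHom A.A A.A => f.app x) A.unit

/-- Evaluating the factors of a formal composite first does not change its value. -/
theorem act_comp {k m : ℕ} (h : k < m) (y x : (freeOn A).top.cell m)
    (hc : (freeOn A).top.Composable h y x) :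
    compA A k h ((actMap A).app y) ((actMap A).app x) ((actMap A).composable hc) =
      (actMap A).app ((freeOn A).top.comp k h y x hc) := by
  let P := (freeOn A).top.toRGSet
  let e : RGHom P ((freeFunctor n).obj P).top.toRGSet := (freeAdj n).unit.app P
  let μ : QHom ((freeFunctor n).obj P) (freeOn A) := (freeAdj n).counit.app (freeOn A)
  let Pθ : QHom ((freeFunctor n).obj P) (freeOn A) := (freeFunctor n).map A.a
  have h1 : ∀ {k : ℕ} (z : P.cell k), μ.top.app (e.app z) = z := fun z =>
    congrArg (fun f : RGHom P P => f.app z) ((freeAdj n).right_triangle_components (freeOn A))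
  have h2 : ∀ {k : ℕ} (z : P.cell k),
      Pθ.top.app (e.app z) = (unitMap A).app ((actMap A).app z) := fun z =>
    (congrArg (fun f : RGHom P P => f.app z) ((freeAdj n).unit.naturality A.a)).symm
  have h3 : ∀ {k : ℕ} (z : ((freeFunctor n).obj P).top.cell k),
      (actMap A).app (μ.top.app z) = (actMap A).app (Pθ.top.app z) := fun z =>
    congrArg (fun f : RGHom ((freeFunctor n).obj P).top.toRGSet A.A => f.app z) A.assoc
  have h4 := h3 (((freeFunctor n).obj P).top.comp k h (e.app y) (e.app x) (e.composable hc))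
  rw [μ.top.map_comp, Pθ.top.map_comp] at h4
  rw [Magma.comp_congr _ h (h1 y) (h1 x), Magma.comp_congr _ h (h2 y) (h2 x)] at h4
  exact h4.symm

end Algebra

/-! ### The category of 2-cells and 3-cells of a Penon 3-category -/

/-- The 2-cells of a Penon 3-category. -/
def TwoCell (A : PenonCat.{u} 3) : Type u := A.A.cell 2

/-- The 3-cells from `α` to `β`. -/
@[ext]
structure ThreeCell {A : PenonCat.{u} 3} (α β : TwoCell A) : Type u where
  cell : A.A.cell 3
  s_cell : A.A.s cell = α
  t_cell : A.A.t cell = β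

section TwoThree

variable {A : PenonCat.{u} 3}

theorem composable_of_eq {f g : A.A.cell 3} (h : A.A.t f = A.A.s g) :
    A.A.Composable (k := 2) (by decide) g f := by
  simpa [RGSet.Composable] using h

/-- Composition of 3-cells along 2-cells. -/
noncomputable def ThreeCell.comp {α β γ : TwoCell A} (f : ThreeCell α β) (g : ThreeCell β γ) :
    ThreeCell α γ where
  cell := compA A 2 (by decide) g.cell f.cell (composable_of_eq (f.t_cell.trans g.s_cell.symm))
  s_cell := by
    rw [compA, ← RGHom.map_s, Magma.s_comp_top, ← RGHom.map_s, act_unit, f.s_cell]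
  t_cell := by
    rw [compA, ← RGHom.map_t, Magma.t_comp_top, ← RGHom.map_t, act_unit, g.t_cell]

/-- The identity 3-cell. -/
def ThreeCell.id (α : TwoCell A) : ThreeCell α α where
  cell := A.A.i (by decide) α
  s_cell := A.A.s_i _ _
  t_cell := A.A.t_i _ _

theorem compA_id (f : A.A.cell 3) (hc : A.A.Composable (k := 2) (by decide) f
    (A.A.i (by decide) (A.A.s f))) :
    compA A 2 (by decide) f (A.A.i (by decide) (A.A.s f)) hc = f := by
  refine Eq.trans ?_ (act_unit f)
  refine congrArg (actMap A).app ((freeOn A).con.eq_of_top _ _ ⟨?_, ?_⟩ ?_)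
  · rw [Magma.s_comp_top, ← RGHom.map_s, ← RGHom.map_s, A.A.s_i]
  · rw [Magma.t_comp_top]
  · rw [MagmaHom.map_comp]
    refine Eq.trans ?_ ((freeOn A).base.comp_id (k := 2) (by decide) _)
    refine Magma.comp_congr _ _ rfl ?_ _
    rw [RGHom.map_i, RGHom.map_i, RGSet.iTo_succ _ le_rfl, RGSet.iTo_self, RGSet.sTo_one,
      RGHom.map_s, RGHom.map_s]

theorem id_compA (f : A.A.cell 3) (hc : A.A.Composable (k := 2) (by decide)
    (A.A.i (by decide) (A.A.t f)) f) :
    compA A 2 (by decide) (A.A.i (by decide) (A.A.t f)) f hc = f := by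
  refine Eq.trans ?_ (act_unit f)
  refine congrArg (actMap A).app ((freeOn A).con.eq_of_top _ _ ⟨?_, ?_⟩ ?_)
  · rw [Magma.s_comp_top]
  · rw [Magma.t_comp_top, ← RGHom.map_t, ← RGHom.map_t, A.A.t_i]
  · rw [MagmaHom.map_comp]
    refine Eq.trans ?_ ((freeOn A).base.id_comp (k := 2) (by decide) _)
    refine Magma.comp_congr _ _ ?_ rfl _
    rw [RGHom.map_i, RGHom.map_i, RGSet.iTo_succ _ le_rfl, RGSet.iTo_self, RGSet.tTo_one,
      RGHom.map_t, RGHom.map_t]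

theorem compA_congr {k m : ℕ} (h : k < m) {y y' x x' : A.A.cell m} (hy : y = y') (hx : x = x')
    (hc : A.A.Composable h y x) :
    compA A k h y x hc = compA A k h y' x' (hy ▸ hx ▸ hc) := by
  subst hy hx; rfl

theorem ThreeCell.comp_assoc {α β γ δ : TwoCell A} (f : ThreeCell α β) (g : ThreeCell β γ)
    (h : ThreeCell γ δ) : (f.comp g).comp h = f.comp (g.comp h) := by
  have hgf := (unitMap A).composable (composable_of_eq (f.t_cell.trans g.s_cell.symm))
  have hhg := (unitMap A).composable (composable_of_eq (g.t_cell.trans h.s_cell.symm))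
  apply ThreeCell.ext
  have h1 := act_comp _ _ _ (Magma.composable_comp_right hhg hgf)
  have h2 := act_comp _ _ _ (Magma.composable_comp_left hhg hgf)
  rw [compA_congr _ (act_unit h.cell) rfl] at h1
  rw [compA_congr _ rfl (act_unit f.cell)] at h2
  refine h1.trans (Eq.trans ?_ h2.symm)
  refine congrArg (actMap A).app ((freeOn A).con.eq_of_top _ _ ⟨?_, ?_⟩ ?_)
  · simp only [Magma.s_comp_top]
  · simp only [Magma.t_comp_top]
  · simp only [MagmaHom.map_comp]
    exact ((freeOn A).base.assoc _ _ _ _ _ _).symm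

/-- The category whose objects are the 2-cells and whose morphisms are the 3-cells of `A`. -/
noncomputable instance : Category (TwoCell A) where
  Hom α β := ThreeCell α β
  id α := ThreeCell.id α
  comp f g := f.comp g
  id_comp f := by
    obtain ⟨f, rfl, rfl⟩ := f
    exact ThreeCell.ext (compA_id f (composable_of_eq (A.A.t_i _ _)))
  comp_id f := by
    obtain ⟨f, rfl, rfl⟩ := f
    exact ThreeCell.ext (id_compA f (composable_of_eq (A.A.s_i _ _).symm))
  assoc f g h := f.comp_assoc g h

end TwoThree

/-! ### Doubly degenerate Penon 3-categories -/

/-- Doubly degenerate: there is exactly one 0-cell and exactly one 1-cell. -/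
structure IsDoublyDegenerate {n : ℕ} (A : RGSet.{u} n) : Prop where
  zero : Nonempty (Unique (A.cell 0))
  one : Nonempty (Unique (A.cell 1))

section DoublyDegenerate

variable {A : PenonCat.{u} 3}

/-- In a doubly degenerate 3-category any two 2-cells, and any two 3-cells, can be composed along
the unique 1-cell. -/
theorem IsDoublyDegenerate.composable {n : ℕ} {A : RGSet.{u} n} (hA : IsDoublyDegenerate A)
    {m : ℕ} (h : 1 < m) (y x : A.cell m) : A.Composable h y x := by
  obtain ⟨_⟩ := hA.one
  exact Subsingleton.elim _ _

/-- The cell `x ∘₁ y` of `A`. -/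
noncomputable def tensorCell (hA : IsDoublyDegenerate A.A) {m : ℕ} (h : 1 < m)
    (x y : A.A.cell m) : A.A.cell m :=
  compA A 1 h x y (hA.composable h x y)

/-- The identity 2-cell on the identity 1-cell on the unique 0-cell. -/
noncomputable def unitCell (hA : IsDoublyDegenerate A.A) : TwoCell A :=
  A.A.i (k := 1) (by decide) (A.A.i (k := 0) (by decide) hA.zero.some.default)

/-- A 2-cell of `A` as a cell of `PA`. -/
noncomputable def formal (α : TwoCell A) : (freeOn A).top.cell 2 := (unitMap A).app (k := 2) α

theorem formal_composable (hA : IsDoublyDegenerate A.A) (α β : TwoCell A) :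
    (freeOn A).top.Composable (k := 1) (by decide) (formal α) (formal β) :=
  (unitMap A).composable (hA.composable (m := 2) (by decide) α β)

/-- The formal composite `α ∘₁ β` in `PA`. -/
noncomputable def formalTwo (hA : IsDoublyDegenerate A.A) (α β : TwoCell A) :
    (freeOn A).top.cell 2 :=
  (freeOn A).top.comp 1 (by decide) (formal α) (formal β) (formal_composable hA α β)

/-- The formal composite `(α ∘₁ β) ∘₁ γ` in `PA`. -/
noncomputable def formalLeft (hA : IsDoublyDegenerate A.A) (α β γ : TwoCell A) :
    (freeOn A).top.cell 2 :=
  (freeOn A).top.comp 1 (by decide) (formalTwo hA α β) (formal γ)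
    (Magma.composable_comp_left (formal_composable hA α β) (formal_composable hA β γ))

/-- The formal composite `α ∘₁ (β ∘₁ γ)` in `PA`. -/
noncomputable def formalRight (hA : IsDoublyDegenerate A.A) (α β γ : TwoCell A) :
    (freeOn A).top.cell 2 :=
  (freeOn A).top.comp 1 (by decide) (formal α) (formalTwo hA β γ)
    (Magma.composable_comp_right (formal_composable hA α β) (formal_composable hA β γ))

end DoublyDegenerate

/-- The 3-cell `c` of `A` is the value `θ[x, y]` of a contraction cell `[x, y]` of `PA`; in
particular this contraction cell exists, i.e. `x` and `y` are parallel and `φ x = φ y`. -/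
def IsContractionValue {A : PenonCat.{u} 3} (x y : (freeOn A).top.cell 2) (c : A.A.cell 3) :
    Prop :=
  ∃ (hp : RGSet.Parallel x y) (hφ : (freeOn A).φ.app x = (freeOn A).φ.app y),
    c = (actMap A).app ((freeOn A).con.cell (by decide) x y hp hφ)

/-- `ι : A → B` exhibits `B` as the free strict `n`-category on `A`. -/
def IsFreeStrictCat {n : ℕ} (A : RGSet.{u} n) (B : StrictCat.{u} n) (ι : RGHom A B.toRGSet) :
    Prop :=
  ∀ (C : StrictCat.{u} n) (g : RGHom A C.toRGSet),
    ∃! f : MagmaHom B.toMagma C.toMagma, ι.comp f.toRGHom = g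

/-- Contraction cells `[x, y]` and `[y, x]` can be composed. -/
theorem composable_con {n : ℕ} (X : QObj.{u} n) {k : ℕ} (hk : k < n) {x y : X.top.cell k}
    (hp : RGSet.Parallel x y) (hφ : X.φ.app x = X.φ.app y)
    (hp' : RGSet.Parallel y x) (hφ' : X.φ.app y = X.φ.app x) :
    X.top.Composable (Nat.lt_succ_self k) (X.con.cell hk x y hp hφ) (X.con.cell hk y x hp' hφ') :=
  Magma.composable_top ((X.con.t_cell hk y x _ _).trans (X.con.s_cell hk x y _ _).symm)

end Penon

open CategoryTheory MonoidalCategory Penon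

/-! Everything rests on two features of a contraction `φ : PA → T_R A`. In dimensions below the top,
cells that become equal in `T_R A` are joined by a contraction cell, which `φ` sends to an identity.
In the top dimension, parallel cells with the same image are equal. Hence any two parallel 3-cells
of `PA` that `φ` sends to identities coincide (`EndHom.IsCoh.eq`), and contraction 3-cells are
mutually inverse (`con_comp_con`).

The only 1-cell of `A` is the identity on `*`. Maps of reflexive globular sets preserve identities,
so its image in `T_R A` is a true identity, and the Eckmann–Hilton argument
(`EndCell.mul_comm_of_iTo`) makes its endomorphisms commute. This produces the contraction cell that
defines the braiding. Since that cell already lies in the top dimension, going back and forth is the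
identity, and the braiding is a symmetry.

Equations in `A` are proved by lifting both sides along `θ` to formal 3-cells with the same
endpoints (`Lifts`) and comparing their images in `T_R A`. Lifting a pasting piece by piece uses
compatibility of `θ` with composition (`act_comp`). It also needs the structural isomorphisms at
arbitrary formal cells, not only at generators: in the pentagon, for example, an index is itself a
product. The algebra law `θμ = θ(Pθ)` supplies this (`act_con_eq`): a contraction cell formed in
`PPA` is sent by `μ` and `Pθ` to contraction cells with unevaluated and evaluated entries, and `θ`
identifies these. The coherence axioms then follow from `Lifts.eq_of_isCoh`, while naturality
reduces to the strict laws of `T_R A`.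

Freeness of `T_R A` follows by testing the universal property of `F` against the objects `1 : C → C`
of `𝒬`. -/

namespace Penon

/-! ### Endomorphisms of a cell -/

/-- The `m`-cells whose iterated source and target in dimension `k` are the `k`-cell `o`. -/
@[ext]
structure EndCell {n : ℕ} (A : RGSet.{u} n) {k : ℕ} (o : A.cell k) {m : ℕ} (h : k < m) where
  cell : A.cell m
  sTo_cell : A.sTo h.le cell = o
  tTo_cell : A.tTo h.le cell = o

namespace EndCell

variable {n k m : ℕ} {h : k < m}

theorem composable {A : RGSet.{u} n} {o : A.cell k} (y x : EndCell A o h) :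
    A.Composable h y.cell x.cell :=
  x.tTo_cell.trans y.sTo_cell.symm

/-- The image under a map of reflexive globular sets. -/
def map {A B : RGSet.{u} n} (f : RGHom A B) {o : A.cell k} {o' : B.cell k} (ho : f.app o = o')
    (x : EndCell A o h) : EndCell B o' h where
  cell := f.app x.cell
  sTo_cell := by rw [← f.map_sTo, x.sTo_cell, ho]
  tTo_cell := by rw [← f.map_tTo, x.tTo_cell, ho]

instance (M : Magma.{u} n) (o : M.cell k) : Mul (EndCell M.toRGSet o h) where
  mul y x :=
    { cell := M.comp k h y.cell x.cell (composable y x)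
      sTo_cell := by rw [M.sTo_comp, x.sTo_cell]
      tTo_cell := by rw [M.tTo_comp, y.tTo_cell] }

theorem mul_cell {M : Magma.{u} n} {o : M.cell k} (y x : EndCell M.toRGSet o h) :
    (y * x).cell = M.comp k h y.cell x.cell (composable y x) := rfl

theorem map_mul {M N : Magma.{u} n} (f : MagmaHom M N) {o : M.cell k} {o' : N.cell k}
    (ho : f.app o = o') (y x : EndCell M.toRGSet o h) :
    (y * x).map f.toRGHom ho = y.map f.toRGHom ho * x.map f.toRGHom ho :=
  EndCell.ext (f.map_comp h _ _ _)

theorem mul_assoc {B : StrictCat.{u} n} {o : B.cell k} (z y x : EndCell B.toRGSet o h) :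
    z * y * x = z * (y * x) :=
  EndCell.ext (B.assoc h _ _ _ _ _)

/-- The iterated identity on `o`. -/
def one {A : RGSet.{u} n} (o : A.cell k) (h : k < m) (hm : m ≤ n) : EndCell A o h where
  cell := A.iTo h.le hm o
  sTo_cell := A.sTo_iTo _ _ _
  tTo_cell := A.tTo_iTo _ _ _

theorem mul_one {B : StrictCat.{u} n} {o : B.cell k} (hm : m ≤ n) (x : EndCell B.toRGSet o h) :
    x * one o h hm = x := by
  refine EndCell.ext (Eq.trans ?_ (B.comp_id h x.cell))
  exact B.comp_congr _ rfl (by rw [x.sTo_cell]; rfl) _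

theorem one_mul {B : StrictCat.{u} n} {o : B.cell k} (hm : m ≤ n) (x : EndCell B.toRGSet o h) :
    one o h hm * x = x := by
  refine EndCell.ext (Eq.trans ?_ (B.id_comp h x.cell))
  exact B.comp_congr _ (by rw [x.tTo_cell]; rfl) rfl _

end EndCell

theorem RGSet.iTo_iTo {n : ℕ} (A : RGSet.{u} n) {j k m : ℕ} (hjk : j ≤ k) (hkm : k ≤ m)
    (hm : m ≤ n) (x : A.cell j) :
    A.iTo hkm hm (A.iTo hjk (hkm.trans hm) x) = A.iTo (hjk.trans hkm) hm x := by
  induction m, hkm using Nat.le_induction with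
  | base => simp
  | succ m hkm ih => rw [A.iTo_succ hkm, A.iTo_succ (hjk.trans hkm), ih]

/-- The Eckmann–Hilton argument: endomorphisms of an identity cell commute. -/
theorem EndCell.mul_comm_of_iTo {n j k m : ℕ} {h : k < m} {B : StrictCat.{u} n} (hjk : j < k)
    (hk : k ≤ n) {o : B.cell k} {w : B.cell j} (ho : o = B.iTo hjk.le hk w)
    (y x : EndCell B.toRGSet o h) : y * x = x * y := by
  have hm : m ≤ n := B.dim_le x.cell
  have hs : ∀ z : EndCell B.toRGSet o h, B.sTo (hjk.trans h).le z.cell = w := fun z => by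
    rw [← B.sTo_sTo hjk.le h.le, z.sTo_cell, ho, B.sTo_iTo]
  have ht : ∀ z : EndCell B.toRGSet o h, B.tTo (hjk.trans h).le z.cell = w := fun z => by
    rw [← B.tTo_tTo hjk.le h.le, z.tTo_cell, ho, B.tTo_iTo]
  have hc : ∀ z z' : EndCell B.toRGSet o h, B.Composable (hjk.trans h) z.cell z'.cell :=
    fun z z' => (ht z').trans (hs z).symm
  -- As `o` is an iterated identity on `w`, the unit for composition along `o` is also the unit for
  -- composition along `w`.
  have hone : (one o h hm : EndCell B.toRGSet o h).cell = B.iTo (hjk.trans h).le hm w := by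
    rw [← B.iTo_iTo hjk.le h.le hm w, ← ho]; rfl
  have r : ∀ z : EndCell B.toRGSet o h,
      B.comp j (hjk.trans h) z.cell (one o h hm : EndCell B.toRGSet o h).cell (hc _ _) = z.cell :=
    fun z => by
      refine Eq.trans ?_ (B.comp_id (hjk.trans h) z.cell)
      exact B.comp_congr _ rfl (by rw [hone, hs]) _
  have l : ∀ z : EndCell B.toRGSet o h,
      B.comp j (hjk.trans h) (one o h hm : EndCell B.toRGSet o h).cell z.cell (hc _ _) = z.cell :=
    fun z => by
      refine Eq.trans ?_ (B.id_comp (hjk.trans h) z.cell)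
      exact B.comp_congr _ (by rw [hone, ht]) rfl _
  have ic : ∀ a b c d : EndCell B.toRGSet o h,
      B.comp j (hjk.trans h) (a * b).cell (c * d).cell (hc _ _) =
        B.comp k h (B.comp j (hjk.trans h) a.cell c.cell (hc _ _))
          (B.comp j (hjk.trans h) b.cell d.cell (hc _ _))
          (B.composable_interchange_right hjk (composable a b) (composable c d) (hc _ _)) :=
    fun a b c d => B.interchange hjk h _ _ _ _ _ _ _
  -- The two placements of the units make the composite of `y` and `x` along `w` equal to `y * x`
  -- and to `x * y`.
  have e₁ := ic y (one o h hm) (one o h hm) x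
  have e₂ := ic (one o h hm) y x (one o h hm)
  rw [B.comp_congr _ (r y) (l x), B.comp_congr _ (congrArg cell (mul_one hm y))
    (congrArg cell (one_mul hm x))] at e₁
  rw [B.comp_congr _ (l x) (r y), B.comp_congr _ (congrArg cell (one_mul hm y))
    (congrArg cell (mul_one hm x))] at e₂
  exact EndCell.ext (e₁.symm.trans e₂)

/-! ### The base of the free object -/

/-- A strict `n`-category as the object `1 : C → C` of `𝒬`. -/
def StrictCat.toQObj {n : ℕ} (C : StrictCat.{u} n) : QObj.{u} n where
  top := C.toMagma
  base := C
  φ := MagmaHom.id C.toMagma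
  -- The identity map identifies only equal cells, so identities serve as contraction cells.
  con :=
    { cell := fun hk x _ _ _ => C.i hk x
      s_cell := fun hk x _ _ _ => C.s_i hk x
      t_cell := fun hk x _ _ hf => (C.t_i hk x).trans hf
      map_cell := fun _ _ _ _ _ => rfl
      cell_self := fun _ _ _ _ => rfl
      eq_of_top := fun _ _ _ hf => hf }

/-- The morphism of `𝒬` from `X` to `1 : C → C` given by a map from the base of `X` to `C`. -/
def QObj.homToQObj {n : ℕ} (X : QObj.{u} n) {C : StrictCat.{u} n}
    (f : MagmaHom X.base.toMagma C.toMagma) : X ⟶ C.toQObj where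
  top := X.φ.comp f
  base := f
  comm _ := rfl
  -- Contraction cells of `X` become identities in its base, and identities are the contraction
  -- cells of the target.
  map_con hk x y hp hf := by
    change f.app (X.φ.app _) = _
    rw [X.con.map_cell, f.map_i]
    rfl

/-- A map from the base to `C` is the same thing as a morphism of `𝒬` to `1 : C → C`: its top
component is forced by the commuting square, and contraction cells are preserved automatically. -/
theorem isFreeStrictCat_freeBase {n : ℕ} (A : RGSet.{u} n) :
    IsFreeStrictCat A (freeBase A) (RGHom.comp (freeUnit A) (freePhi A).toRGHom) := by
  intro C g
  refine ⟨(freeLift C.toQObj g).base, ?_, fun f hf => ?_⟩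
  · refine Eq.trans ?_ (freeUnit_lift C.toQObj g)
    refine RGHom.ext ?_
    funext k a
    exact (QHom.comm (freeLift C.toQObj g) _).symm
  · exact (congrArg QHom.base (freeLift_unique C.toQObj ((freeQ A).homToQObj f) g hf)).symm

/-- The adjunction is built from `freeQ` and `freeUnit`, so its object and unit unfold to these by
definition. -/
theorem isFreeStrictCat_freeOn {n : ℕ} (A : PenonCat.{u} n) :
    IsFreeStrictCat A.A (freeOn A).base ((unitMap A).comp (freeOn A).φ.toRGHom) :=
  isFreeStrictCat_freeBase A.A

end Penon

namespace Penon

/-! ### Cells between endomorphisms -/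

/-- The `(m + 1)`-cells between two endomorphisms of `o` of dimension `m`. -/
@[ext]
structure EndHom {n : ℕ} {A : RGSet.{u} n} {k m : ℕ} {o : A.cell k} {h : k < m}
    (x y : EndCell A o h) where
  cell : A.cell (m + 1)
  s_cell : A.s cell = x.cell
  t_cell : A.t cell = y.cell

namespace EndHom

section RGSet

variable {n k m : ℕ} {h : k < m} {A B : RGSet.{u} n} {o : A.cell k}

/-- A cell between endomorphisms of `o` is an endomorphism of `o`. -/
def toEndCell {x y : EndCell A o h} (c : EndHom x y) : EndCell A o (h.trans m.lt_succ_self) where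
  cell := c.cell
  sTo_cell := by rw [A.sTo_succ h.le, c.s_cell, x.sTo_cell]
  tTo_cell := by rw [A.tTo_succ h.le, c.t_cell, y.tTo_cell]

/-- The identity. -/
def id (hm : m < n) (x : EndCell A o h) : EndHom x x where
  cell := A.i hm x.cell
  s_cell := A.s_i _ _
  t_cell := A.t_i _ _

theorem composable {x y z : EndCell A o h} (c : EndHom x y) (d : EndHom y z) :
    A.Composable m.lt_succ_self d.cell c.cell := by
  simpa [RGSet.Composable] using c.t_cell.trans d.s_cell.symm

end RGSet

section Magma

variable {n k m : ℕ} {h : k < m} {M : Magma.{u} n} {o : M.cell k}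

/-- Composition along `m`-cells, in diagrammatic order. -/
def comp {x y z : EndCell M.toRGSet o h} (c : EndHom x y) (d : EndHom y z) : EndHom x z where
  cell := M.comp m m.lt_succ_self d.cell c.cell (composable c d)
  s_cell := by rw [M.s_comp_top, c.s_cell]
  t_cell := by rw [M.t_comp_top, d.t_cell]

/-- Composition along `o`. -/
def mul {x x' y y' : EndCell M.toRGSet o h} (c : EndHom x x') (d : EndHom y y') :
    EndHom (x * y) (x' * y') where
  cell := (c.toEndCell * d.toEndCell).cell
  s_cell := by
    rw [EndCell.mul_cell, M.s_comp _ h]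
    exact M.comp_congr _ c.s_cell d.s_cell _
  t_cell := by
    rw [EndCell.mul_cell, M.t_comp _ h]
    exact M.comp_congr _ c.t_cell d.t_cell _

end Magma

/-! ### Images in the base of cells between endomorphisms -/

section QObj

variable {n k m : ℕ} {h : k < m} {X : QObj.{u} n} {o : X.top.cell k}

/-- One dimension above `o`, source and target are `o` itself. Contraction cells between such
endomorphisms therefore need only equality in the base. -/
theorem _root_.Penon.EndCell.parallel {h : k < k + 1} {A : RGSet.{u} n} {o : A.cell k}
    (x y : EndCell A o h) : RGSet.Parallel x.cell y.cell := by
  constructor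
  · simpa using x.sTo_cell.trans y.sTo_cell.symm
  · simpa using x.tTo_cell.trans y.tTo_cell.symm

/-- The image in the base of an endomorphism. -/
abbrev _root_.Penon.EndCell.phi (x : EndCell X.top.toRGSet o h) :
    EndCell X.base.toRGSet (X.φ.app o) h :=
  x.map X.φ.toRGHom rfl

/-- The image in the base of a cell between endomorphisms. -/
abbrev phi {x y : EndCell X.top.toRGSet o h} (c : EndHom x y) :
    EndCell X.base.toRGSet (X.φ.app o) (h.trans m.lt_succ_self) :=
  c.toEndCell.phi

/-- The cells that become identities in the base. -/
def IsCoh (hm : m < n) {x y : EndCell X.top.toRGSet o h} (c : EndHom x y) : Prop :=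
  c.phi = (id hm x.phi).toEndCell

theorem phi_mul {x x' y y' : EndCell X.top.toRGSet o h} (c : EndHom x x') (d : EndHom y y') :
    (c.mul d).phi = c.phi * d.phi :=
  EndCell.map_mul X.φ rfl _ _

theorem phi_id (hm : m < n) (x : EndCell X.top.toRGSet o h) :
    (id hm x).phi = (id hm x.phi).toEndCell :=
  EndCell.ext (X.φ.map_i hm _)

theorem isCoh_id (hm : m < n) (x : EndCell X.top.toRGSet o h) : (id hm x).IsCoh hm :=
  phi_id hm x

/-- Compare targets: the image of `c` is an identity on the image of `x`, while `c` ends at `y`. -/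
theorem phi_eq_of_isCoh {hm : m < n} {x y : EndCell X.top.toRGSet o h} {c : EndHom x y}
    (hc : c.IsCoh hm) : x.phi = y.phi := by
  have e : X.φ.app c.cell = X.base.i hm (X.φ.app x.cell) := congrArg EndCell.cell hc
  have e' := congrArg X.base.t e
  rw [← X.φ.map_t, c.t_cell, X.base.t_i] at e'
  exact EndCell.ext e'.symm

/-- Identities are units in the base, so a coherence cell can be dropped from a composite after
applying `φ`. Naturality squares are simplified in this way. -/
theorem phi_comp_of_isCoh_left {hm : m < n} {x y z : EndCell X.top.toRGSet o h} {c : EndHom x y}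
    (hc : c.IsCoh hm) (d : EndHom y z) : (c.comp d).phi = d.phi := by
  refine EndCell.ext ((X.φ.map_comp _ _ _ _).trans ?_)
  refine Eq.trans ?_ (X.base.comp_id m.lt_succ_self (X.φ.app d.cell))
  refine X.base.comp_congr _ rfl ?_ _
  rw [X.base.iTo_succ le_rfl, X.base.iTo_self, X.base.sTo_one, ← X.φ.map_s, d.s_cell]
  exact (congrArg EndCell.cell hc).trans
    (congrArg (X.base.i hm) (congrArg EndCell.cell (phi_eq_of_isCoh hc)))

theorem phi_comp_of_isCoh_right {hm : m < n} {x y z : EndCell X.top.toRGSet o h} (c : EndHom x y)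
    {d : EndHom y z} (hd : d.IsCoh hm) : (c.comp d).phi = c.phi := by
  refine EndCell.ext ((X.φ.map_comp _ _ _ _).trans ?_)
  refine Eq.trans ?_ (X.base.id_comp m.lt_succ_self (X.φ.app c.cell))
  refine X.base.comp_congr _ ?_ rfl _
  rw [X.base.iTo_succ le_rfl, X.base.iTo_self, X.base.tTo_one, ← X.φ.map_t, c.t_cell]
  exact congrArg EndCell.cell hd

theorem IsCoh.comp {hm : m < n} {x y z : EndCell X.top.toRGSet o h} {c : EndHom x y}
    {d : EndHom y z} (hc : c.IsCoh hm) (hd : d.IsCoh hm) : (c.comp d).IsCoh hm :=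
  (phi_comp_of_isCoh_right c hd).trans hc

/-- In a strict category a composite of identities along a lower cell is again an identity
(`i_comp`). -/
theorem IsCoh.mul {hm : m < n} {x x' y y' : EndCell X.top.toRGSet o h} {c : EndHom x x'}
    {d : EndHom y y'} (hc : c.IsCoh hm) (hd : d.IsCoh hm) : (c.mul d).IsCoh hm := by
  unfold IsCoh at *
  rw [phi_mul, hc, hd]
  refine EndCell.ext ?_
  refine (X.base.i_comp h hm _ _ (EndCell.composable x.phi y.phi)).symm.trans ?_
  exact congrArg (X.base.i hm) (X.φ.map_comp h _ _ _).symm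

/-- Interchange holds in the base. -/
theorem phi_mul_comp_mul {x y z x' y' z' : EndCell X.top.toRGSet o h} (c : EndHom x y)
    (d : EndHom y z) (c' : EndHom x' y') (d' : EndHom y' z') :
    ((c.mul c').comp (d.mul d')).phi = ((c.comp d).mul (c'.comp d')).phi := by
  refine EndCell.ext ?_
  refine (X.φ.map_comp _ _ _ _).trans (Eq.trans ?_ (X.φ.map_comp _ _ _ _).symm)
  refine (X.base.comp_congr _ (X.φ.map_comp _ _ _ _) (X.φ.map_comp _ _ _ _) _).trans
    (Eq.trans ?_ (X.base.comp_congr _ (X.φ.map_comp _ _ _ _) (X.φ.map_comp _ _ _ _) _).symm)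
  exact (X.base.interchange h m.lt_succ_self _ _ _ _ (X.φ.composable (composable c d))
    (X.φ.composable (composable c' d'))
    (X.φ.composable (EndCell.composable c.toEndCell c'.toEndCell))).symm

end QObj

/-! ### Rigidity in the top dimension -/

section Top

variable {m k : ℕ} {h : k < m} {X : QObj.{u} (m + 1)} {o : X.top.cell k}

/-- Here `m + 1` is the top dimension of `X`, where a contraction is an equality. Through this, the
strict laws of the base become laws for formal 3-cells. -/
theorem ext_of_phi {x y : EndCell X.top.toRGSet o h} {c d : EndHom x y} (e : c.phi = d.phi) :
    c = d :=
  EndHom.ext (X.con.eq_of_top _ _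
    ⟨c.s_cell.trans d.s_cell.symm, c.t_cell.trans d.t_cell.symm⟩ (congrArg EndCell.cell e))

/-- The coherence theorem in formal form: every diagram built from contraction cells and identities
of top dimension commutes. -/
theorem IsCoh.eq {x y : EndCell X.top.toRGSet o h} {c d : EndHom x y}
    (hc : c.IsCoh m.lt_succ_self) (hd : d.IsCoh m.lt_succ_self) : c = d :=
  ext_of_phi (hc.trans hd.symm)

end Top

section Con

variable {n k : ℕ} {h : k < k + 1} {X Y : QObj.{u} n} {o : X.top.cell k}

/-- A contraction cell between endomorphisms. -/
def con (hk : k + 1 < n) (x y : EndCell X.top.toRGSet o h) (e : x.phi = y.phi) :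
    EndHom x y where
  cell := X.con.cell hk x.cell y.cell (EndCell.parallel x y) (congrArg EndCell.cell e)
  s_cell := X.con.s_cell _ _ _ _ _
  t_cell := X.con.t_cell _ _ _ _ _

theorem isCoh_con (hk : k + 1 < n) (x y : EndCell X.top.toRGSet o h) (e : x.phi = y.phi) :
    (con hk x y e).IsCoh hk :=
  EndCell.ext (X.con.map_cell _ _ _ _ _)

/-- The images of the endpoints are variables with equations, so that they can be presented as
products of formal cells. -/
theorem map_con (f : QHom X Y) {o' : Y.top.cell k} (ho : f.top.app o = o') (hk : k + 1 < n)
    {x y : EndCell X.top.toRGSet o h} (e : x.phi = y.phi) {x' y' : EndCell Y.top.toRGSet o' h}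
    (hx : x.map f.top.toRGHom ho = x') (hy : y.map f.top.toRGHom ho = y') (e' : x'.phi = y'.phi) :
    f.top.app (con hk x y e).cell = (con hk x' y' e').cell := by
  subst hx hy
  exact f.map_con hk _ _ _ _

end Con

end EndHom

/-- Contraction cells of top dimension are mutually inverse. -/
theorem con_comp_con {m : ℕ} (X : QObj.{u} (m + 1)) {x y : X.top.cell m}
    (hp : RGSet.Parallel x y) (hφ : X.φ.app x = X.φ.app y) (hp' : RGSet.Parallel y x)
    (hφ' : X.φ.app y = X.φ.app x) :
    X.top.comp m m.lt_succ_self (X.con.cell m.lt_succ_self x y hp hφ)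
        (X.con.cell m.lt_succ_self y x hp' hφ') (composable_con X m.lt_succ_self hp hφ hp' hφ') =
      X.top.i m.lt_succ_self y := by
  refine X.con.eq_of_top _ _ ⟨?_, ?_⟩ ?_
  · rw [X.top.s_comp_top, X.con.s_cell, X.top.s_i]
  · rw [X.top.t_comp_top, X.con.t_cell, X.top.t_i]
  -- Both factors become the identity on the common image of `x` and `y`, and an identity composed
  -- with itself is itself.
  · rw [X.φ.map_comp, X.φ.map_i]
    refine Eq.trans ?_ (X.base.comp_id m.lt_succ_self _)
    refine X.base.comp_congr _ ?_ ?_ _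
    · rw [X.con.map_cell, hφ]
    · rw [X.base.iTo_succ le_rfl, X.base.iTo_self, X.base.sTo_one, X.base.s_i, X.con.map_cell]

end Penon

namespace Penon

/-! ### Strict laws for the images of formal endomorphisms -/

namespace EndCell

variable {n k m : ℕ} {h : k < m} {X : QObj.{u} n} {o : X.top.cell k}

theorem phi_mul (x y : EndCell X.top.toRGSet o h) : (x * y).phi = x.phi * y.phi :=
  map_mul X.φ rfl _ _

theorem phi_mul_assoc (x y z : EndCell X.top.toRGSet o h) :
    (x * y * z).phi = (x * (y * z)).phi := by
  simp only [phi_mul, mul_assoc]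

/-- `φ` preserves identities, so the images are endomorphisms of an identity 1-cell of a strict
category, and Eckmann–Hilton applies. -/
theorem phi_mul_comm {h : 1 < m} {hn : 0 < n} {o : X.top.cell 1} {w : X.top.cell 0}
    (ho : o = X.top.i hn w) (x y : EndCell X.top.toRGSet o h) : x.phi * y.phi = y.phi * x.phi := by
  refine mul_comm_of_iTo (w := X.φ.app w) one_pos hn ?_ _ _
  rw [ho, X.φ.map_i, X.base.iTo_succ le_rfl, X.base.iTo_self]

theorem phi_one (o : X.top.cell k) (h : k < m) (hm : m ≤ n) :
    (one o h hm : EndCell X.top.toRGSet o h).phi = one (X.φ.app o) h hm :=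
  EndCell.ext (X.φ.map_iTo _ _ _)

theorem map_one {A B : RGSet.{u} n} (f : RGHom A B) {o : A.cell k} {o' : B.cell k}
    (ho : f.app o = o') (h : k < m) (hm : m ≤ n) : (one o h hm).map f ho = one o' h hm := by
  subst ho
  exact EndCell.ext (f.map_iTo _ _ _)

theorem phi_one_mul (hm : m ≤ n) (x : EndCell X.top.toRGSet o h) :
    (one o h hm * x).phi = x.phi := by
  rw [phi_mul, phi_one, one_mul]

theorem phi_mul_one (hm : m ≤ n) (x : EndCell X.top.toRGSet o h) :
    (x * one o h hm).phi = x.phi := by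
  rw [phi_mul, phi_one, mul_one]

end EndCell

/-- Lets the identity 3-cell on the unit object act as a unit on 3-cells, in the naturality of the
unitors. -/
theorem EndHom.phi_id_one {n k m : ℕ} {X : QObj.{u} n} (o : X.top.cell k) (h : k < m)
    (hm : m < n) : (EndHom.id hm (EndCell.one o h hm.le)).phi =
      EndCell.one (X.φ.app o) (h.trans m.lt_succ_self) hm := by
  rw [EndHom.phi_id, EndCell.phi_one]
  exact EndCell.ext (X.base.iTo_succ h.le _ _ _).symm

/-- The object `PPA` with the two morphisms `μ` and `Pθ` to `PA`, which `θ` coequalizes. -/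
theorem exists_free_free {n : ℕ} (A : PenonCat.{u} n) :
    ∃ (Y : QObj.{u} n) (e : RGHom (freeOn A).top.toRGSet Y.top.toRGSet)
      (μ ν : QHom Y (freeOn A)),
      (∀ {k : ℕ} (z : (freeOn A).top.cell k), μ.top.app (e.app z) = z) ∧
      (∀ {k : ℕ} (z : (freeOn A).top.cell k),
        ν.top.app (e.app z) = (unitMap A).app ((actMap A).app z)) ∧
      (∀ {k : ℕ} (z : Y.top.cell k),
        (actMap A).app (μ.top.app z) = (actMap A).app (ν.top.app z)) := by
  let P := (freeOn A).top.toRGSet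
  refine ⟨(freeFunctor n).obj P, (freeAdj n).unit.app P, (freeAdj n).counit.app (freeOn A),
    (freeFunctor n).map A.a, fun z => ?_, fun z => ?_, fun z => ?_⟩
  -- The three properties are a triangle identity, naturality of the unit at `θ`, and the
  -- associativity law of the algebra.
  · exact congrArg (fun f : RGHom P P => f.app z)
      ((freeAdj n).right_triangle_components (freeOn A))
  · exact (congrArg (fun f : RGHom P P => f.app z) ((freeAdj n).unit.naturality A.a)).symm
  · exact congrArg (fun f : RGHom ((freeFunctor n).obj P).top.toRGSet A.A => f.app z) A.assoc

/-! ### Formal expressions in a doubly degenerate Penon 3-category -/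

section DoublyDegenerate

variable {A : PenonCat.{u} 3} (hA : IsDoublyDegenerate A.A)

/-- The unique 1-cell, as a cell of `PA`. -/
noncomputable def formalOne : (freeOn A).top.cell 1 :=
  (unitMap A).app (A.A.i (k := 0) (by decide) hA.zero.some.default)

/-- `η` preserves identities. This is the input to Eckmann–Hilton in the base of the free object. -/
theorem formalOne_eq : formalOne hA =
    (freeOn A).top.i (k := 0) (by decide) ((unitMap A).app hA.zero.some.default) :=
  (unitMap A).map_i _ _

/-- The formal endomorphisms of the unique 1-cell, of dimension `m`. -/
abbrev FormalCell {m : ℕ} (h : 1 < m) : Type u := EndCell (freeOn A).top.toRGSet (formalOne hA) h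

/-- A cell of `A` as a cell of `PA`. -/
noncomputable def formalCell {m : ℕ} (h : 1 < m) (x : A.A.cell m) : FormalCell hA h where
  cell := (unitMap A).app x
  sTo_cell := by
    obtain ⟨_⟩ := hA.one
    rw [← RGHom.map_sTo]
    exact congrArg _ (Subsingleton.elim _ _)
  tTo_cell := by
    obtain ⟨_⟩ := hA.one
    rw [← RGHom.map_tTo]
    exact congrArg _ (Subsingleton.elim _ _)

/-- A 2-cell of `A` as a cell of `PA`. -/
noncomputable abbrev formalObj (α : TwoCell A) : FormalCell hA one_lt_two :=
  formalCell hA one_lt_two α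

/-- The 2-cell of `A` given by a formal 2-cell. -/
def FormalCell.eval {hA : IsDoublyDegenerate A.A} (x : FormalCell hA one_lt_two) : TwoCell A :=
  (actMap A).app x.cell

/-- The tensor product of 2-cells. -/
noncomputable def tensorObj (α β : TwoCell A) : TwoCell A :=
  tensorCell hA (m := 2) one_lt_two α β

theorem eval_formalObj (α : TwoCell A) : (formalObj hA α).eval = α := act_unit (k := 2) α

theorem eval_mul (x y : FormalCell hA one_lt_two) :
    (x * y).eval = tensorObj hA x.eval y.eval :=
  (act_comp one_lt_two x.cell y.cell (EndCell.composable x y)).symm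

/-- Since `η` commutes with `i`, the generator on the unit object is an iterated identity of `PA`,
and `φ` makes it a strict unit. -/
theorem formalObj_unitCell :
    formalObj hA (unitCell hA) = EndCell.one (formalOne hA) one_lt_two (by decide) := by
  refine EndCell.ext (((unitMap A).map_i _ _).trans ?_)
  exact ((RGSet.iTo_succ _ le_rfl one_le_two _ _).trans
    (congrArg _ (RGSet.iTo_self _ _ _))).symm

variable {hA}

/-- The value of a contraction cell of `PA` can be computed by first evaluating subexpressions. -/
theorem act_con_eq {Y : QObj.{u} 3} (e : RGHom (freeOn A).top.toRGSet Y.top.toRGSet)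
    {μ ν : QHom Y (freeOn A)} (hμν : ∀ {k : ℕ} (z : Y.top.cell k),
        (actMap A).app (μ.top.app z) = (actMap A).app (ν.top.app z))
    (hμ : μ.top.app (e.app (formalOne hA)) = formalOne hA)
    (hν : ν.top.app (e.app (formalOne hA)) = formalOne hA)
    {x y : EndCell Y.top.toRGSet (e.app (formalOne hA)) one_lt_two} (hxy : x.phi = y.phi)
    {x' y' x'' y'' : FormalCell hA one_lt_two} (hx' : x.map μ.top.toRGHom hμ = x')
    (hy' : y.map μ.top.toRGHom hμ = y') (hx'' : x.map ν.top.toRGHom hν = x'')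
    (hy'' : y.map ν.top.toRGHom hν = y'') (h' : x'.phi = y'.phi) (h'' : x''.phi = y''.phi) :
    (actMap A).app (EndHom.con (by decide) x' y' h').cell =
      (actMap A).app (EndHom.con (by decide) x'' y'' h'').cell := by
  -- Both sides come from the single contraction cell of `Y` from `x` to `y`, whose two images `θ`
  -- identifies.
  rw [← EndHom.map_con μ hμ (by decide) hxy hx' hy' h', hμν,
    EndHom.map_con ν hν (by decide) hxy hx'' hy'' h'']

/-- The morphism of `A` given by a formal contraction cell. -/
noncomputable def conHom {x y : FormalCell hA one_lt_two} (h : x.phi = y.phi) {α β : TwoCell A}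
    (hα : x.eval = α) (hβ : y.eval = β) : α ⟶ β where
  cell := (actMap A).app (EndHom.con (by decide) x y h).cell
  s_cell := by rw [← RGHom.map_s, EndHom.s_cell]; exact hα
  t_cell := by rw [← RGHom.map_t, EndHom.t_cell]; exact hβ

/-- The formal 3-cell `c` evaluates to the morphism `f` of `A`. -/
def Lifts {x y : FormalCell hA one_lt_two} (c : EndHom x y) {α β : TwoCell A} (f : α ⟶ β) :
    Prop :=
  (actMap A).app c.cell = f.cell

/-- The morphism `f` of `A` as a formal 3-cell. -/
noncomputable def formalHom (hA : IsDoublyDegenerate A.A) {α β : TwoCell A} (f : α ⟶ β) :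
    EndHom (formalObj hA α) (formalObj hA β) where
  cell := (unitMap A).app f.cell
  s_cell := by rw [← RGHom.map_s, f.s_cell]; rfl
  t_cell := by rw [← RGHom.map_t, f.t_cell]; rfl

theorem lifts_formalHom {α β : TwoCell A} (f : α ⟶ β) : Lifts (formalHom hA f) f :=
  act_unit f.cell

theorem lifts_conHom {x y : FormalCell hA one_lt_two} (h : x.phi = y.phi) {α β : TwoCell A}
    (hα : x.eval = α) (hβ : y.eval = β) :
    Lifts (EndHom.con (by decide) x y h) (conHom h hα hβ) := rfl

/-- Both lifts must have literally the same formal endpoints; endpoints with merely equal values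
under `θ` would not do. -/
theorem Lifts.eq {x y : FormalCell hA one_lt_two} {c d : EndHom x y} {α β : TwoCell A}
    {f g : α ⟶ β} (hc : Lifts c f) (hd : Lifts d g) (h : c = d) : f = g :=
  ThreeCell.ext (hc.symm.trans (h ▸ hd))

theorem lifts_id {x : FormalCell hA one_lt_two} {α : TwoCell A} (hα : x.eval = α) :
    Lifts (EndHom.id (by decide) x) (𝟙 α) := by
  subst hα
  exact (actMap A).map_i _ _

/-- By `act_comp`, `θ` respects composition. Together with `Lifts.tensor`, this allows a pasting to
be lifted piece by piece. -/
theorem Lifts.comp {x y z : FormalCell hA one_lt_two} {c : EndHom x y} {d : EndHom y z}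
    {α β γ : TwoCell A} {f : α ⟶ β} {g : β ⟶ γ} (hc : Lifts c f) (hd : Lifts d g) :
    Lifts (c.comp d) (f ≫ g) :=
  (act_comp _ _ _ (EndHom.composable c d)).symm.trans (compA_congr _ hd hc _)

/-- The tensor product of morphisms. -/
noncomputable def tensorHom (hA : IsDoublyDegenerate A.A) {α α' β β' : TwoCell A} (f : α ⟶ α')
    (g : β ⟶ β') : tensorObj hA α β ⟶ tensorObj hA α' β' where
  cell := tensorCell hA (by decide) f.cell g.cell
  s_cell := (((actMap A).map_s _).symm.trans
    (congrArg (actMap A).app ((formalHom hA f).mul (formalHom hA g)).s_cell))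
  t_cell := (((actMap A).map_t _).symm.trans
    (congrArg (actMap A).app ((formalHom hA f).mul (formalHom hA g)).t_cell))

theorem Lifts.tensor {x x' y y' : FormalCell hA one_lt_two} {c : EndHom x x'} {d : EndHom y y'}
    {α α' β β' : TwoCell A} {f : α ⟶ α'} {g : β ⟶ β'} (hc : Lifts c f) (hd : Lifts d g) :
    Lifts (c.mul d) (tensorHom hA f g) :=
  (act_comp _ _ _ (EndCell.composable c.toEndCell d.toEndCell)).symm.trans (compA_congr _ hc hd _)

end DoublyDegenerate

end Penon

namespace Penon

/-! ### The structural isomorphisms and their formal lifts -/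

section DoublyDegenerate

variable {A : PenonCat.{u} 3} {hA : IsDoublyDegenerate A.A}

theorem Lifts.eval_source {x y : FormalCell hA one_lt_two} {c : EndHom x y} {α β : TwoCell A}
    {f : α ⟶ β} (hc : Lifts c f) : x.eval = α := by
  rw [FormalCell.eval, ← c.s_cell, RGHom.map_s, hc]
  exact f.s_cell

theorem Lifts.eval_target {x y : FormalCell hA one_lt_two} {c : EndHom x y} {α β : TwoCell A}
    {f : α ⟶ β} (hc : Lifts c f) : y.eval = β := by
  rw [FormalCell.eval, ← c.t_cell, RGHom.map_t, hc]
  exact f.t_cell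

/-- The coherence principle in `A`; pentagon, triangle, hexagons and symmetry are instances of it.
-/
theorem Lifts.eq_of_isCoh {x y : FormalCell hA one_lt_two} {c d : EndHom x y} {α β : TwoCell A}
    {f g : α ⟶ β} (hc : Lifts c f) (hd : Lifts d g) (hc' : c.IsCoh (by decide))
    (hd' : d.IsCoh (by decide)) : f = g :=
  hc.eq hd (hc'.eq hd')

/-- The isomorphism of `A` given by a formal contraction cell. -/
noncomputable def conIso {x y : FormalCell hA one_lt_two} (h : x.phi = y.phi) {α β : TwoCell A}
    (hα : x.eval = α) (hβ : y.eval = β) : α ≅ β where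
  hom := conHom h hα hβ
  inv := conHom h.symm hβ hα
  hom_inv_id := ((lifts_conHom h hα hβ).comp (lifts_conHom h.symm hβ hα)).eq_of_isCoh
    (lifts_id hα) ((EndHom.isCoh_con _ _ _ _).comp (EndHom.isCoh_con _ _ _ _))
    (EndHom.isCoh_id _ _)
  inv_hom_id := ((lifts_conHom h.symm hβ hα).comp (lifts_conHom h hα hβ)).eq_of_isCoh
    (lifts_id hβ) ((EndHom.isCoh_con _ _ _ _).comp (EndHom.isCoh_con _ _ _ _))
    (EndHom.isCoh_id _ _)

/-- An isomorphism is determined by its forward morphism, so `f` is the isomorphism `conIso` with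
the opposite contraction cell as inverse. -/
theorem Lifts.inv {x y : FormalCell hA one_lt_two} {h : x.phi = y.phi} {α β : TwoCell A}
    {f : α ≅ β} (hf : Lifts (EndHom.con (by decide) x y h) f.hom) :
    Lifts (EndHom.con (by decide) y x h.symm) f.inv := by
  have hx := hf.eval_source
  have hy := hf.eval_target
  have e : f = conIso h hx hy := by
    ext1
    exact hf.eq (lifts_conHom h hx hy) rfl
  rw [e]
  exact lifts_conHom h.symm hy hx

variable (hA)

theorem phi_formal_mul_comm (x y : FormalCell hA one_lt_two) : (x * y).phi = (y * x).phi := by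
  rw [EndCell.phi_mul, EndCell.phi_mul, EndCell.phi_mul_comm (formalOne_eq hA)]

theorem phi_unitCell_mul (x : FormalCell hA one_lt_two) :
    (formalObj hA (unitCell hA) * x).phi = x.phi := by
  rw [formalObj_unitCell, EndCell.phi_one_mul]

theorem phi_mul_unitCell (x : FormalCell hA one_lt_two) :
    (x * formalObj hA (unitCell hA)).phi = x.phi := by
  rw [formalObj_unitCell, EndCell.phi_mul_one]

/-- The associator. -/
noncomputable def assocIso (α β γ : TwoCell A) :
    tensorObj hA (tensorObj hA α β) γ ≅ tensorObj hA α (tensorObj hA β γ) :=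
  conIso (EndCell.phi_mul_assoc (formalObj hA α) (formalObj hA β) (formalObj hA γ))
    (by simp only [eval_mul, eval_formalObj]) (by simp only [eval_mul, eval_formalObj])

/-- The left unitor. -/
noncomputable def leftUnitIso (α : TwoCell A) : tensorObj hA (unitCell hA) α ≅ α :=
  conIso (phi_unitCell_mul hA (formalObj hA α))
    (by simp only [eval_mul, eval_formalObj]) (eval_formalObj hA α)

/-- The right unitor. -/
noncomputable def rightUnitIso (α : TwoCell A) : tensorObj hA α (unitCell hA) ≅ α :=
  conIso (phi_mul_unitCell hA (formalObj hA α))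
    (by simp only [eval_mul, eval_formalObj]) (eval_formalObj hA α)

/-- The braiding. -/
noncomputable def braidIso (α β : TwoCell A) : tensorObj hA α β ≅ tensorObj hA β α :=
  conIso (phi_formal_mul_comm hA (formalObj hA α) (formalObj hA β))
    (by simp only [eval_mul, eval_formalObj]) (by simp only [eval_mul, eval_formalObj])

variable {hA}

/-- Two consecutive changes of base on an endomorphism of the unique 1-cell. -/
theorem map_map_eq {Y : QObj.{u} 3} {e : RGHom (freeOn A).top.toRGSet Y.top.toRGSet}
    {ν : QHom Y (freeOn A)} (hν : ν.top.app (e.app (formalOne hA)) = formalOne hA)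
    {x x' : FormalCell hA one_lt_two} (h : ν.top.app (e.app x.cell) = x'.cell) :
    (x.map e rfl).map ν.top.toRGHom hν = x' :=
  EndCell.ext h

section

variable {x y z : FormalCell hA one_lt_two} {α β γ : TwoCell A}

/-- The associator is defined at generators, but axioms need it at arbitrary formal cells. The
contraction cell is formed in `PPA` on the images of `x`, `y`, `z`; `μ` returns these cells and `Pθ`
replaces each by the generator on its value. -/
theorem lifts_assocIso (hx : x.eval = α) (hy : y.eval = β) (hz : z.eval = γ) :
    Lifts (EndHom.con (by decide) (x * y * z) (x * (y * z)) (EndCell.phi_mul_assoc x y z))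
      (assocIso hA α β γ).hom := by
  subst hx hy hz
  obtain ⟨Y, e, μ, ν, hμ, hν, hμν⟩ := exists_free_free A
  have hνo : ν.top.app (e.app (formalOne hA)) = formalOne hA := by
    rw [hν, formalOne, act_unit]
  have h₁ := fun w : FormalCell hA one_lt_two => map_map_eq (hμ (formalOne hA)) (hμ w.cell)
  have h₂ := fun w : FormalCell hA one_lt_two =>
    map_map_eq (x' := formalObj hA w.eval) hνo (hν w.cell)
  refine act_con_eq e hμν (hμ _) hνo
    (EndCell.phi_mul_assoc (x.map e rfl) (y.map e rfl) (z.map e rfl)) ?_ ?_ ?_ ?_ _ _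
  all_goals simp only [EndCell.map_mul, h₁, h₂]

theorem lifts_leftUnitIso (hx : x.eval = α) :
    Lifts (EndHom.con (by decide) (formalObj hA (unitCell hA) * x) x (phi_unitCell_mul hA x))
      (leftUnitIso hA α).hom := by
  subst hx
  obtain ⟨Y, e, μ, ν, hμ, hν, hμν⟩ := exists_free_free A
  have hνo : ν.top.app (e.app (formalOne hA)) = formalOne hA := by
    rw [hν, formalOne, act_unit]
  have h₁ := fun w : FormalCell hA one_lt_two => map_map_eq (hμ (formalOne hA)) (hμ w.cell)
  have h₂ := fun w : FormalCell hA one_lt_two =>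
    map_map_eq (x' := formalObj hA w.eval) hνo (hν w.cell)
  -- The unit factor in `Y` is the iterated identity, which both maps carry to the formal unit.
  refine act_con_eq e hμν (hμ _) hνo (EndCell.phi_one_mul (by decide) (x.map e rfl))
    ?_ ?_ ?_ ?_ _ _
  all_goals simp only [EndCell.map_mul, EndCell.map_one, formalObj_unitCell, h₁, h₂]

theorem lifts_rightUnitIso (hx : x.eval = α) :
    Lifts (EndHom.con (by decide) (x * formalObj hA (unitCell hA)) x (phi_mul_unitCell hA x))
      (rightUnitIso hA α).hom := by
  subst hx
  obtain ⟨Y, e, μ, ν, hμ, hν, hμν⟩ := exists_free_free A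
  have hνo : ν.top.app (e.app (formalOne hA)) = formalOne hA := by
    rw [hν, formalOne, act_unit]
  have h₁ := fun w : FormalCell hA one_lt_two => map_map_eq (hμ (formalOne hA)) (hμ w.cell)
  have h₂ := fun w : FormalCell hA one_lt_two =>
    map_map_eq (x' := formalObj hA w.eval) hνo (hν w.cell)
  refine act_con_eq e hμν (hμ _) hνo (EndCell.phi_mul_one (by decide) (x.map e rfl))
    ?_ ?_ ?_ ?_ _ _
  all_goals simp only [EndCell.map_mul, EndCell.map_one, formalObj_unitCell, h₁, h₂]

theorem lifts_braidIso (hx : x.eval = α) (hy : y.eval = β) :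
    Lifts (EndHom.con (by decide) (x * y) (y * x) (phi_formal_mul_comm hA x y))
      (braidIso hA α β).hom := by
  subst hx hy
  obtain ⟨Y, e, μ, ν, hμ, hν, hμν⟩ := exists_free_free A
  have hνo : ν.top.app (e.app (formalOne hA)) = formalOne hA := by
    rw [hν, formalOne, act_unit]
  have h₁ := fun w : FormalCell hA one_lt_two => map_map_eq (hμ (formalOne hA)) (hμ w.cell)
  have h₂ := fun w : FormalCell hA one_lt_two =>
    map_map_eq (x' := formalObj hA w.eval) hνo (hν w.cell)
  -- The contraction cell must already exist in `Y`. As `e` preserves identities, the base 1-cell is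
  -- an identity there too, and Eckmann–Hilton applies again.
  have ho := (congrArg e.app (formalOne_eq hA)).trans (e.map_i _ _)
  have hc : (x.map e rfl * y.map e rfl).phi = (y.map e rfl * x.map e rfl).phi := by
    rw [EndCell.phi_mul, EndCell.phi_mul, EndCell.phi_mul_comm ho]
  refine act_con_eq e hμν (hμ _) hνo hc ?_ ?_ ?_ ?_ _ _
  all_goals simp only [EndCell.map_mul, h₁, h₂]

end

/-! ### The symmetric monoidal category -/

open MonoidalCategory

variable (hA)

/-- The data of the monoidal category of 2-cells and 3-cells. -/
@[reducible]
noncomputable def monoidalStruct : MonoidalCategoryStruct (TwoCell A) where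
  tensorObj := tensorObj hA
  tensorHom := tensorHom hA
  whiskerLeft α _ _ g := tensorHom hA (𝟙 α) g
  whiskerRight f β := tensorHom hA f (𝟙 β)
  tensorUnit := unitCell hA
  associator := assocIso hA
  leftUnitor := leftUnitIso hA
  rightUnitor := rightUnitIso hA

theorem tensorHom_id_id (α β : TwoCell A) :
    tensorHom hA (𝟙 α) (𝟙 β) = 𝟙 (tensorObj hA α β) := by
  have hα := eval_formalObj hA α
  have hβ := eval_formalObj hA β
  refine ((lifts_id hα).tensor (lifts_id hβ)).eq_of_isCoh (lifts_id ?_)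
    ((EndHom.isCoh_id _ _).mul (EndHom.isCoh_id _ _)) (EndHom.isCoh_id _ _)
  rw [eval_mul, hα, hβ]

/-- Interchange is an axiom only in the base; rigidity in the top dimension carries it back to
formal 3-cells. -/
theorem tensorHom_comp_tensorHom {α β γ α' β' γ' : TwoCell A} (f : α ⟶ β) (f' : α' ⟶ β')
    (g : β ⟶ γ) (g' : β' ⟶ γ') :
    tensorHom hA f f' ≫ tensorHom hA g g' = tensorHom hA (f ≫ g) (f' ≫ g') := by
  have hf := lifts_formalHom (hA := hA) f
  have hf' := lifts_formalHom (hA := hA) f'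
  have hg := lifts_formalHom (hA := hA) g
  have hg' := lifts_formalHom (hA := hA) g'
  exact ((hf.tensor hf').comp (hg.tensor hg')).eq ((hf.comp hg).tensor (hf'.comp hg'))
    (EndHom.ext_of_phi (EndHom.phi_mul_comp_mul _ _ _ _))

theorem assocIso_naturality {α β γ α' β' γ' : TwoCell A} (f : α ⟶ α') (g : β ⟶ β')
    (h : γ ⟶ γ') :
    tensorHom hA (tensorHom hA f g) h ≫ (assocIso hA α' β' γ').hom =
      (assocIso hA α β γ).hom ≫ tensorHom hA f (tensorHom hA g h) := by
  have hf := lifts_formalHom (hA := hA) f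
  have hg := lifts_formalHom (hA := hA) g
  have hh := lifts_formalHom (hA := hA) h
  refine (((hf.tensor hg).tensor hh).comp (lifts_assocIso hf.eval_target hg.eval_target
    hh.eval_target)).eq ((lifts_assocIso hf.eval_source hg.eval_source hh.eval_source).comp
    (hf.tensor (hg.tensor hh))) (EndHom.ext_of_phi ?_)
  -- Without the associators, strict associativity of 3-cells in the base remains.
  rw [EndHom.phi_comp_of_isCoh_right _ (EndHom.isCoh_con _ _ _ _),
    EndHom.phi_comp_of_isCoh_left (EndHom.isCoh_con _ _ _ _)]
  simp only [EndHom.phi_mul, EndCell.mul_assoc]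

theorem leftUnitIso_naturality {α β : TwoCell A} (f : α ⟶ β) :
    tensorHom hA (𝟙 (unitCell hA)) f ≫ (leftUnitIso hA β).hom =
      (leftUnitIso hA α).hom ≫ f := by
  have hf := lifts_formalHom (hA := hA) f
  refine (((lifts_id (eval_formalObj hA _)).tensor hf).comp (lifts_leftUnitIso
    hf.eval_target)).eq ((lifts_leftUnitIso hf.eval_source).comp hf) (EndHom.ext_of_phi ?_)
  rw [EndHom.phi_comp_of_isCoh_right _ (EndHom.isCoh_con _ _ _ _),
    EndHom.phi_comp_of_isCoh_left (EndHom.isCoh_con _ _ _ _), EndHom.phi_mul,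
    formalObj_unitCell, EndHom.phi_id_one, EndCell.one_mul]

theorem rightUnitIso_naturality {α β : TwoCell A} (f : α ⟶ β) :
    tensorHom hA f (𝟙 (unitCell hA)) ≫ (rightUnitIso hA β).hom =
      (rightUnitIso hA α).hom ≫ f := by
  have hf := lifts_formalHom (hA := hA) f
  refine ((hf.tensor (lifts_id (eval_formalObj hA _))).comp (lifts_rightUnitIso
    hf.eval_target)).eq ((lifts_rightUnitIso hf.eval_source).comp hf) (EndHom.ext_of_phi ?_)
  rw [EndHom.phi_comp_of_isCoh_right _ (EndHom.isCoh_con _ _ _ _),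
    EndHom.phi_comp_of_isCoh_left (EndHom.isCoh_con _ _ _ _), EndHom.phi_mul,
    formalObj_unitCell, EndHom.phi_id_one, EndCell.mul_one]

/-- Eckmann–Hilton one dimension up: the formal 3-cells are also endomorphisms of the identity
1-cell, so their images commute. -/
theorem braidIso_naturality {α α' β β' : TwoCell A} (f : α ⟶ α') (g : β ⟶ β') :
    tensorHom hA f g ≫ (braidIso hA α' β').hom =
      (braidIso hA α β).hom ≫ tensorHom hA g f := by
  have hf := lifts_formalHom (hA := hA) f
  have hg := lifts_formalHom (hA := hA) g
  refine ((hf.tensor hg).comp (lifts_braidIso hf.eval_target hg.eval_target)).eq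
    ((lifts_braidIso hf.eval_source hg.eval_source).comp (hg.tensor hf)) (EndHom.ext_of_phi ?_)
  rw [EndHom.phi_comp_of_isCoh_right _ (EndHom.isCoh_con _ _ _ _),
    EndHom.phi_comp_of_isCoh_left (EndHom.isCoh_con _ _ _ _), EndHom.phi_mul, EndHom.phi_mul,
    EndCell.phi_mul_comm (formalOne_eq hA)]

theorem assocIso_pentagon (α β γ δ : TwoCell A) :
    tensorHom hA (assocIso hA α β γ).hom (𝟙 δ) ≫ (assocIso hA α (tensorObj hA β γ) δ).hom ≫
        tensorHom hA (𝟙 α) (assocIso hA β γ δ).hom =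
      (assocIso hA (tensorObj hA α β) γ δ).hom ≫ (assocIso hA α β (tensorObj hA γ δ)).hom := by
  have ha := eval_formalObj hA α
  have hb := eval_formalObj hA β
  have hc := eval_formalObj hA γ
  have hd := eval_formalObj hA δ
  -- A product index is represented by a formal product, not by a generator, so that consecutive
  -- formal cells compose.
  have h₂ : ∀ {x y : FormalCell hA one_lt_two} {ξ υ : TwoCell A}, x.eval = ξ → y.eval = υ →
      (x * y).eval = tensorObj hA ξ υ := by rintro x y _ _ rfl rfl; exact eval_mul hA x y
  exact (((lifts_assocIso ha hb hc).tensor (lifts_id hd)).comp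
    ((lifts_assocIso ha (h₂ hb hc) hd).comp ((lifts_id ha).tensor
      (lifts_assocIso hb hc hd)))).eq_of_isCoh
    ((lifts_assocIso (h₂ ha hb) hc hd).comp (lifts_assocIso ha hb (h₂ hc hd)))
    (((EndHom.isCoh_con _ _ _ _).mul (EndHom.isCoh_id _ _)).comp
      ((EndHom.isCoh_con _ _ _ _).comp ((EndHom.isCoh_id _ _).mul (EndHom.isCoh_con _ _ _ _))))
    ((EndHom.isCoh_con _ _ _ _).comp (EndHom.isCoh_con _ _ _ _))

theorem assocIso_triangle (α β : TwoCell A) :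
    (assocIso hA α (unitCell hA) β).hom ≫ tensorHom hA (𝟙 α) (leftUnitIso hA β).hom =
      tensorHom hA (rightUnitIso hA α).hom (𝟙 β) := by
  have ha := eval_formalObj hA α
  have hb := eval_formalObj hA β
  exact ((lifts_assocIso ha (eval_formalObj hA _) hb).comp
    ((lifts_id ha).tensor (lifts_leftUnitIso hb))).eq_of_isCoh
    ((lifts_rightUnitIso ha).tensor (lifts_id hb))
    ((EndHom.isCoh_con _ _ _ _).comp ((EndHom.isCoh_id _ _).mul (EndHom.isCoh_con _ _ _ _)))
    ((EndHom.isCoh_con _ _ _ _).mul (EndHom.isCoh_id _ _))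

theorem braidIso_hexagon_forward (α β γ : TwoCell A) :
    (assocIso hA α β γ).hom ≫ (braidIso hA α (tensorObj hA β γ)).hom ≫
        (assocIso hA β γ α).hom =
      tensorHom hA (braidIso hA α β).hom (𝟙 γ) ≫ (assocIso hA β α γ).hom ≫
        tensorHom hA (𝟙 β) (braidIso hA α γ).hom := by
  have ha := eval_formalObj hA α
  have hb := eval_formalObj hA β
  have hc := eval_formalObj hA γ
  -- The braiding past `β ⊗ γ` is lifted at the formal product, to match the adjacent associators.
  have hbc := eval_mul hA (formalObj hA β) (formalObj hA γ)
  rw [hb, hc] at hbc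
  exact ((lifts_assocIso ha hb hc).comp
    ((lifts_braidIso ha hbc).comp (lifts_assocIso hb hc ha))).eq_of_isCoh
    (((lifts_braidIso ha hb).tensor (lifts_id hc)).comp ((lifts_assocIso hb ha hc).comp
      ((lifts_id hb).tensor (lifts_braidIso ha hc))))
    ((EndHom.isCoh_con _ _ _ _).comp ((EndHom.isCoh_con _ _ _ _).comp (EndHom.isCoh_con _ _ _ _)))
    (((EndHom.isCoh_con _ _ _ _).mul (EndHom.isCoh_id _ _)).comp
      ((EndHom.isCoh_con _ _ _ _).comp ((EndHom.isCoh_id _ _).mul (EndHom.isCoh_con _ _ _ _))))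

theorem braidIso_hexagon_reverse (α β γ : TwoCell A) :
    (assocIso hA α β γ).inv ≫ (braidIso hA (tensorObj hA α β) γ).hom ≫
        (assocIso hA γ α β).inv =
      tensorHom hA (𝟙 α) (braidIso hA β γ).hom ≫ (assocIso hA α γ β).inv ≫
        tensorHom hA (braidIso hA α γ).hom (𝟙 β) := by
  have ha := eval_formalObj hA α
  have hb := eval_formalObj hA β
  have hc := eval_formalObj hA γ
  have hab := eval_mul hA (formalObj hA α) (formalObj hA β)
  rw [ha, hb] at hab
  exact ((lifts_assocIso ha hb hc).inv.comp
    ((lifts_braidIso hab hc).comp (lifts_assocIso hc ha hb).inv)).eq_of_isCoh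
    (((lifts_id ha).tensor (lifts_braidIso hb hc)).comp ((lifts_assocIso ha hc hb).inv.comp
      ((lifts_braidIso ha hc).tensor (lifts_id hb))))
    ((EndHom.isCoh_con _ _ _ _).comp ((EndHom.isCoh_con _ _ _ _).comp (EndHom.isCoh_con _ _ _ _)))
    (((EndHom.isCoh_id _ _).mul (EndHom.isCoh_con _ _ _ _)).comp
      ((EndHom.isCoh_con _ _ _ _).comp ((EndHom.isCoh_con _ _ _ _).mul (EndHom.isCoh_id _ _))))

/-- The composite lifts to two opposite contraction cells, which becomes an identity in the base;
this forces the braiding to be symmetric. -/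
theorem braidIso_symmetry (α β : TwoCell A) :
    (braidIso hA α β).hom ≫ (braidIso hA β α).hom = 𝟙 (tensorObj hA α β) := by
  have ha := eval_formalObj hA α
  have hb := eval_formalObj hA β
  refine ((lifts_braidIso ha hb).comp (lifts_braidIso hb ha)).eq_of_isCoh (lifts_id ?_)
    ((EndHom.isCoh_con _ _ _ _).comp (EndHom.isCoh_con _ _ _ _)) (EndHom.isCoh_id _ _)
  rw [eval_mul, ha, hb]

/-- The monoidal category of 2-cells and 3-cells. -/
@[reducible]
noncomputable def monoidal : MonoidalCategory (TwoCell A) :=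
  letI := monoidalStruct hA
  MonoidalCategory.ofTensorHom
    (id_tensorHom_id := tensorHom_id_id hA)
    (id_tensorHom := fun _ _ _ _ => rfl)
    (tensorHom_id := fun _ _ => rfl)
    (tensorHom_comp_tensorHom := tensorHom_comp_tensorHom hA)
    (associator_naturality := assocIso_naturality hA)
    (leftUnitor_naturality := leftUnitIso_naturality hA)
    (rightUnitor_naturality := rightUnitIso_naturality hA)
    (pentagon := assocIso_pentagon hA)
    (triangle := assocIso_triangle hA)

/-- The symmetric monoidal category of 2-cells and 3-cells. -/
@[reducible]
noncomputable def symmetric : @SymmetricCategory (TwoCell A) _ (monoidal hA) :=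
  letI := monoidal hA
  { braiding := braidIso hA
    braiding_naturality_right := fun α _ _ f => braidIso_naturality hA (𝟙 α) f
    braiding_naturality_left := fun f β => braidIso_naturality hA f (𝟙 β)
    hexagon_forward := braidIso_hexagon_forward hA
    hexagon_reverse := braidIso_hexagon_reverse hA
    symmetry := braidIso_symmetry hA }

variable {hA} in
theorem Lifts.isContractionValue {x y : FormalCell hA one_lt_two} {h : x.phi = y.phi}
    {α β : TwoCell A} {f : α ⟶ β} (hf : Lifts (EndHom.con (by decide) x y h) f) :
    IsContractionValue x.cell y.cell f.cell :=
  ⟨EndCell.parallel x y, congrArg EndCell.cell h, hf.symm⟩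

end DoublyDegenerate

end Penon

theorem mainTheorem1 (A : PenonCat.{u} 3) (hA : IsDoublyDegenerate A.A) :
    -- the base of the free object on `A` is the free strict 3-category `T_R A`
    IsFreeStrictCat A.A (freeOn A).base ((unitMap A).comp (freeOn A).φ.toRGHom) ∧
    -- `α ∘ β = β ∘ α` in `T_R A`, so that the contraction cell `[α ∘ β, β ∘ α]` exists
    (∀ α β : TwoCell A, (freeOn A).φ.app (formalTwo hA α β) =
      (freeOn A).φ.app (formalTwo hA β α)) ∧
    -- `[x, y] ∘ [y, x] = 1` for every contraction 3-cell `[x, y]` of `PA`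
    (∀ (x y : (freeOn A).top.cell 2) (hp : RGSet.Parallel x y)
      (hφ : (freeOn A).φ.app x = (freeOn A).φ.app y) (hp' : RGSet.Parallel y x)
      (hφ' : (freeOn A).φ.app y = (freeOn A).φ.app x),
      (freeOn A).top.comp 2 (by decide) ((freeOn A).con.cell (by decide) x y hp hφ)
          ((freeOn A).con.cell (by decide) y x hp' hφ')
          (composable_con (freeOn A) (by decide) hp hφ hp' hφ') =
        (freeOn A).top.i (by decide) y) ∧
    -- the 2-cells and 3-cells of `A` form a symmetric monoidal category, with the stated data
    ∃ (_ : MonoidalCategory (TwoCell A)) (_ : SymmetricCategory (TwoCell A)),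
      (∀ α β : TwoCell A, α ⊗ β = tensorCell hA (m := 2) (by decide) α β) ∧
      (∀ (α α' β β' : TwoCell A) (f : α ⟶ α') (g : β ⟶ β'),
        (f ⊗ₘ g).cell = tensorCell hA (by decide) f.cell g.cell) ∧
      𝟙_ (TwoCell A) = unitCell hA ∧
      (∀ α β γ : TwoCell A, IsContractionValue (formalLeft hA α β γ) (formalRight hA α β γ)
        (α_ α β γ).hom.cell) ∧
      (∀ α : TwoCell A, IsContractionValue (formalTwo hA (unitCell hA) α) (formal α)
        (λ_ α).hom.cell) ∧
      (∀ α : TwoCell A, IsContractionValue (formalTwo hA α (unitCell hA)) (formal α)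
        (ρ_ α).hom.cell) ∧
      (∀ α β : TwoCell A, IsContractionValue (formalTwo hA α β) (formalTwo hA β α)
        ((β_ α β).hom : α ⊗ β ⟶ β ⊗ α).cell) := by
  -- The formal composites in the statement unfold to the underlying cells of products of
  -- generators, so the general lemmas apply directly.
  refine ⟨isFreeStrictCat_freeOn A, fun α β => congrArg EndCell.cell
    (phi_formal_mul_comm hA (formalObj hA α) (formalObj hA β)),
    fun x y hp hφ hp' hφ' => con_comp_con (freeOn A) hp hφ hp' hφ',
    monoidal hA, symmetric hA, fun _ _ => rfl, fun _ _ _ _ _ _ => rfl, rfl,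
    fun α β γ => (lifts_assocIso (eval_formalObj hA α) (eval_formalObj hA β)
      (eval_formalObj hA γ)).isContractionValue,
    fun α => (lifts_leftUnitIso (eval_formalObj hA α)).isContractionValue,
    fun α => (lifts_rightUnitIso (eval_formalObj hA α)).isContractionValue,
    fun α β => (lifts_braidIso (eval_formalObj hA α) (eval_formalObj hA β)).isContractionValue⟩
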